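/- Let $d\ge 1$, let $\Omega\subset\mathbb{R}^d$ be a bounded domain (nonempty, open, connected), and let $\alpha,\beta\ge 0$ and $K_0,K_1,K_2>0$. Then there exists a constant $K_3>0$, depending only on $d$, $\Omega$, $\alpha$, $\beta$, $K_0$, $K_1$, $K_2$, such that the following holds for every $n\in\mathbb{N}$ and all functions $w_1,\dots,w_n$ on $[0,\infty)\times\Omega$. Suppose that for all $i=1,\dots,n$ * $w_i^{q/2}\in L^2(0,T;H^1(\Omega))\cap C^0([0,T];L^2(\Omega))$ for all $q\in\mathbb{N}$ with $q\ge 2$ and all $T>0$; * $w_i(t)\ge 0$ a.e. in $\Omega$ for all $t\ge 0$; * $w_i=0$ on $\partial\Omega$, i.e. $w_i(t)\in H^1_0(\Omega)$ for a.e. $t>0$; * $w_i(0)=0$ a.e. in $\Omega$; and that for all $q\in\mathbb{N}$ with $q\ge 2$ and all $t>0$ $$ \int_\Omega e^t\sum_{i=1}^n w_i(t)^q\,dx+K_0\int_0^t\int_\Omega e^s\sum_{i=1}^n|\nabla w_i^{q/2}|^2\,dx\,ds \le K_1q^\alpha\int_0^t\int_\Omega e^s\sum_{i=1}^n w_i^q\,dx\,ds+K_2q^\beta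 e^t . $$ Then, for all $i=1,\dots,n$ and all $t>0$, $$ w_i(t)\le K_3\Big(\sum_{j=1}^n\|w_j\|_{L^\infty(0,\infty;L^1(\Omega))}+1\Big)\quad\text{a.e. in }\Omega , $$ where the bound is understood as trivial if the right-hand side is infinite. -/

import Mathlib

open MeasureTheory Set Filter Topology
open scoped ENNReal ContDiff Gradient

noncomputable section

namespace BoundIter

/-- `φ ∈ C_c^∞(Ω)`: smooth with compact support contained in `Ω`. -/
def IsTestFunction {d : ℕ} (Ω : Set (EuclideanSpace ℝ (Fin d)))
    (φ : EuclideanSpace ℝ (Fin d) → ℝ) : Prop :=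
  ContDiff ℝ ∞ φ ∧ HasCompactSupport φ ∧ tsupport φ ⊆ Ω

/-- `g` is a weak (distributional) gradient of `u` on `Ω`. -/
def HasWeakGradient {d : ℕ} (Ω : Set (EuclideanSpace ℝ (Fin d)))
    (u : EuclideanSpace ℝ (Fin d) → ℝ)
    (g : EuclideanSpace ℝ (Fin d) → EuclideanSpace ℝ (Fin d)) : Prop :=
  LocallyIntegrableOn u Ω ∧ LocallyIntegrableOn g Ω ∧
    ∀ φ : EuclideanSpace ℝ (Fin d) → ℝ, IsTestFunction Ω φ →
      ∫ x in Ω, u x • ∇ φ x = - ∫ x in Ω, φ x • g x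

/-- Weak gradients are unique almost everywhere. -/
theorem HasWeakGradient.ae_eq {d : ℕ} {Ω : Set (EuclideanSpace ℝ (Fin d))} (hΩ : IsOpen Ω)
    {u : EuclideanSpace ℝ (Fin d) → ℝ}
    {g₁ g₂ : EuclideanSpace ℝ (Fin d) → EuclideanSpace ℝ (Fin d)}
    (h₁ : HasWeakGradient Ω u g₁) (h₂ : HasWeakGradient Ω u g₂) :
    g₁ =ᵐ[volume.restrict Ω] g₂ := by
  have key : ∀ᵐ x ∂volume, x ∈ Ω → (g₁ - g₂) x = 0 := by
    refine hΩ.ae_eq_zero_of_integral_contDiff_smul_eq_zero (h₁.2.1.sub h₂.2.1) ?_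
    intro φ hφ hc hs
    have hint : ∀ {g : EuclideanSpace ℝ (Fin d) → EuclideanSpace ℝ (Fin d)},
        LocallyIntegrableOn g Ω → IntegrableOn (fun x => φ x • g x) (tsupport φ) := by
      intro g hg
      exact (hg.integrableOn_compact_subset hs hc).continuousOn_smul
        hφ.continuous.continuousOn hc
    have hz : ∀ {g : EuclideanSpace ℝ (Fin d) → EuclideanSpace ℝ (Fin d)},
        ∀ x, x ∉ tsupport φ → φ x • g x = 0 := by
      intro g x hx
      rw [image_eq_zero_of_notMem_tsupport hx, zero_smul]
    have e : ∫ x in Ω, φ x • g₁ x = ∫ x in Ω, φ x • g₂ x :=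
      neg_injective ((h₁.2.2 φ ⟨hφ, hc, hs⟩).symm.trans (h₂.2.2 φ ⟨hφ, hc, hs⟩))
    rw [setIntegral_eq_integral_of_forall_compl_eq_zero (fun x hx => hz x fun h => hx (hs h)),
      setIntegral_eq_integral_of_forall_compl_eq_zero (fun x hx => hz x fun h => hx (hs h))] at e
    have i₁ := (integrableOn_iff_integrable_of_support_subset (fun x hx => by
      by_contra h; exact hx (hz x h))).1 (hint h₁.2.1)
    have i₂ := (integrableOn_iff_integrable_of_support_subset (fun x hx => by
      by_contra h; exact hx (hz x h))).1 (hint h₂.2.1)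
    simp only [Pi.sub_apply, smul_sub]
    rw [integral_sub i₁ i₂, e, sub_self]
  filter_upwards [(ae_restrict_iff' hΩ.measurableSet).2 key] with x hx
  exact sub_eq_zero.1 hx

open Classical in
/-- The weak gradient `∇u` on `Ω` (unique up to null sets; zero if `u` has no weak gradient). -/
def weakGradient {d : ℕ} (Ω : Set (EuclideanSpace ℝ (Fin d)))
    (u : EuclideanSpace ℝ (Fin d) → ℝ) :
    EuclideanSpace ℝ (Fin d) → EuclideanSpace ℝ (Fin d) :=
  if h : ∃ g, HasWeakGradient Ω u g then h.choose else 0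

/-- `u ∈ H¹₀(Ω)`: `u` lies in the closure of `C_c^∞(Ω)` with respect to the norm of `H¹(Ω)`.
This is the meaning of `u = 0` on `∂Ω` for `u ∈ H¹(Ω)`. -/
def MemH10 {d : ℕ} (Ω : Set (EuclideanSpace ℝ (Fin d)))
    (u : EuclideanSpace ℝ (Fin d) → ℝ) : Prop :=
  MemLp u 2 (volume.restrict Ω) ∧
    ∃ g : EuclideanSpace ℝ (Fin d) → EuclideanSpace ℝ (Fin d),
      HasWeakGradient Ω u g ∧ MemLp g 2 (volume.restrict Ω) ∧
      ∃ φ : ℕ → EuclideanSpace ℝ (Fin d) → ℝ,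
        (∀ k, IsTestFunction Ω (φ k)) ∧
        Tendsto (fun k => eLpNorm (fun x => φ k x - u x) 2 (volume.restrict Ω)) atTop (𝓝 0) ∧
        Tendsto (fun k => eLpNorm (fun x => ∇ (φ k) x - g x) 2 (volume.restrict Ω)) atTop (𝓝 0)

/-- `u ∈ L²(0,T;H¹(Ω))`. As `H¹(Ω)` is, through `v ↦ (v, ∇v)`, a closed subspace of
`L²(Ω) × L²(Ω)^d`, this says that `t ↦ u(t)` and `t ↦ ∇u(t)` are square integrable in the
sense of Bochner, with values in `L²(Ω)` and `L²(Ω)^d`. -/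
def MemL2H1 {d : ℕ} (Ω : Set (EuclideanSpace ℝ (Fin d))) (T : ℝ)
    (u : ℝ → EuclideanSpace ℝ (Fin d) → ℝ) : Prop :=
  ∃ (U : ℝ → Lp ℝ 2 (volume.restrict Ω))
    (G : ℝ → Lp (EuclideanSpace ℝ (Fin d)) 2 (volume.restrict Ω)),
    MemLp U 2 (volume.restrict (Ioo 0 T)) ∧ MemLp G 2 (volume.restrict (Ioo 0 T)) ∧
    ∀ᵐ t ∂(volume.restrict (Ioo 0 T)),
      U t =ᵐ[volume.restrict Ω] u t ∧ HasWeakGradient Ω (u t) (G t)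

/-- `u ∈ C⁰([0,T];L²(Ω))`. -/
def MemC0L2 {d : ℕ} (Ω : Set (EuclideanSpace ℝ (Fin d))) (T : ℝ)
    (u : ℝ → EuclideanSpace ℝ (Fin d) → ℝ) : Prop :=
  ∃ U : ℝ → Lp ℝ 2 (volume.restrict Ω), ContinuousOn U (Icc 0 T) ∧
    ∀ t ∈ Icc 0 T, U t =ᵐ[volume.restrict Ω] u t

/-- The norm of `u` in `L^∞(0,∞;L¹(Ω))`, with the value `∞` allowed. -/
def normLinftyL1 {d : ℕ} (Ω : Set (EuclideanSpace ℝ (Fin d)))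
    (u : ℝ → EuclideanSpace ℝ (Fin d) → ℝ) : ℝ≥0∞ :=
  essSup (fun t => eLpNorm (u t) 1 (volume.restrict Ω)) (volume.restrict (Ioi 0))

end BoundIter

end

noncomputable section

namespace BoundIter

/-! This is a Moser–Alikakos iteration along the exponents `2 ^ k`. Write `b k` for a bound on `∑ i,
∫ w i t ^ 2 ^ k` that is uniform in time. The energy inequality with `q = 2 * 2 ^ k` controls the
next moment once the integral of `w ^ q` on its right is absorbed by the gradient term. Absorption
comes from Nash's inequality in additive form, `2‖v‖₂² ≤ h²‖∇v‖₂² + 2|B_h|⁻¹‖v‖₁²`, applied to `v =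
w ^ (q / 2)`: its `L¹` norm is the previous moment, and the radius `h` is free. Since `∫₀ᵗ eˢ ds ≤
eᵗ`, the weight makes the outcome independent of `t` (`integral_pow_step`).

Taking `h` as a negative power of `q` keeps all constants polynomial in `q`
(`exists_iteration_constants`), so `b (k + 1) ≤ D * R ^ k * b k ^ 2`. The explicit solution
`iterBound` grows like `(D * R * Y) ^ 2 ^ k` with `Y = S + 1`, where `S` is the sum of the `L¹`
norms. Hence all `L^(2^k)` norms are at most `D * R * (S + 1)`, and so is the essential supremum.

The delicate point is Nash's inequality for powers: `w` is in `H¹₀`, but `w ^ m` is only known to be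
in `H¹`. Truncated powers, which are `C¹` with bounded derivative, preserve zero boundary values and
approximate `w ^ m` from below (`IsH1Limit.nash_pow`). Functions are extended by zero, so `∂Ω` needs
no regularity. -/

/-! ### Nash's inequality for compactly supported `C¹` functions -/

theorem eLpNorm_two_sq {α E : Type*} [MeasurableSpace α] [NormedAddCommGroup E]
    (f : α → E) (μ : Measure α) : eLpNorm f 2 μ ^ 2 = ∫⁻ x, ‖f x‖ₑ ^ 2 ∂μ := by
  have := eLpNorm_nnreal_pow_eq_lintegral (f := f) (μ := μ) (p := 2) two_ne_zero
  simpa using this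

theorem enorm_gradient {d : ℕ} (f : EuclideanSpace ℝ (Fin d) → ℝ)
    (x : EuclideanSpace ℝ (Fin d)) : ‖∇ f x‖ₑ = ‖fderiv ℝ f x‖ₑ := by
  rw [gradient]
  exact LinearIsometryEquiv.enorm_map _ _

theorem continuous_gradient {d : ℕ} {f : EuclideanSpace ℝ (Fin d) → ℝ} (hf : ContDiff ℝ 1 f) :
    Continuous (∇ f) :=
  (LinearIsometryEquiv.continuous _).comp (hf.continuous_fderiv one_ne_zero)

theorem tsupport_gradient_subset {d : ℕ} (f : EuclideanSpace ℝ (Fin d) → ℝ) :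
    tsupport (∇ f) ⊆ tsupport f := by
  refine subset_trans ?_ (tsupport_fderiv_subset ℝ (f := f))
  exact tsupport_comp_subset (map_zero _) (fderiv ℝ f)

/-- Integrate the derivative along the segment from `x` to `x + y`, use Cauchy–Schwarz on the unit
interval, then Tonelli and translation invariance. -/
theorem lintegral_sq_translate_sub_le {d : ℕ} {f : EuclideanSpace ℝ (Fin d) → ℝ}
    (hf : ContDiff ℝ 1 f) (y : EuclideanSpace ℝ (Fin d)) :
    ∫⁻ x, ‖f (x + y) - f x‖ₑ ^ 2 ≤ ‖y‖ₑ ^ 2 * ∫⁻ x, ‖∇ f x‖ₑ ^ 2 := by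
  have hg := continuous_gradient hf
  have pt : ∀ x, ‖f (x + y) - f x‖ₑ ^ 2 ≤
      ∫⁻ s in Ioc (0 : ℝ) 1, ‖y‖ₑ ^ 2 * ‖∇ f (x + s • y)‖ₑ ^ 2 := by
    intro x
    have hc : Continuous fun s : ℝ => fderiv ℝ f (x + s • y) y :=
      ((hf.continuous_fderiv one_ne_zero).comp (by fun_prop)).clm_apply continuous_const
    have hd : ∀ s ∈ uIcc (0 : ℝ) 1,
        HasDerivAt (fun s : ℝ => f (x + s • y)) (fderiv ℝ f (x + s • y) y) s := by
      intro s _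
      have h1 : HasDerivAt (fun s : ℝ => x + s • y) y s := by
        simpa using ((hasDerivAt_id s).smul_const y).const_add x
      exact ((hf.differentiable one_ne_zero _).hasFDerivAt).comp_hasDerivAt s h1
    have e := intervalIntegral.integral_eq_sub_of_hasDerivAt hd (hc.intervalIntegrable _ _)
    simp only [one_smul, zero_smul, add_zero] at e
    rw [← e, intervalIntegral.integral_of_le zero_le_one]
    have : IsProbabilityMeasure (volume.restrict (Ioc (0 : ℝ) 1)) := ⟨by simp⟩
    calc ‖∫ s in Ioc (0 : ℝ) 1, fderiv ℝ f (x + s • y) y‖ₑ ^ 2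
        ≤ (eLpNorm (fun s : ℝ => fderiv ℝ f (x + s • y) y) 2
            (volume.restrict (Ioc (0 : ℝ) 1))) ^ 2 := by
          gcongr
          refine (enorm_integral_le_lintegral_enorm _).trans ?_
          rw [← eLpNorm_one_eq_lintegral_enorm]
          exact eLpNorm_le_eLpNorm_of_exponent_le one_le_two hc.aestronglyMeasurable
      _ ≤ _ := by
          rw [eLpNorm_two_sq]
          refine lintegral_mono fun s => ?_
          rw [← mul_pow, mul_comm, enorm_gradient]
          gcongr
          exact ContinuousLinearMap.le_opENorm _ _
  calc ∫⁻ x, ‖f (x + y) - f x‖ₑ ^ 2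
      ≤ ∫⁻ x, ∫⁻ s in Ioc (0 : ℝ) 1, ‖y‖ₑ ^ 2 * ‖∇ f (x + s • y)‖ₑ ^ 2 := lintegral_mono pt
    _ = ∫⁻ s in Ioc (0 : ℝ) 1, ∫⁻ x, ‖y‖ₑ ^ 2 * ‖∇ f (x + s • y)‖ₑ ^ 2 := by
        refine lintegral_lintegral_swap (Continuous.measurable ?_).aemeasurable
        have : Continuous fun p : EuclideanSpace ℝ (Fin d) × ℝ => ‖∇ f (p.1 + p.2 • y)‖ₑ ^ 2 :=
          (ENNReal.continuous_pow 2).comp (hg.comp (by fun_prop)).enorm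
        exact (ENNReal.continuous_const_mul (by finiteness)).comp this
    _ = ∫⁻ s in Ioc (0 : ℝ) 1, ‖y‖ₑ ^ 2 * ∫⁻ x, ‖∇ f x‖ₑ ^ 2 := by
        congr 1 with s
        rw [lintegral_const_mul' _ _ (by finiteness),
          lintegral_add_right_eq_self (fun x => ‖∇ f x‖ₑ ^ 2) (s • y)]
    _ = _ := by simp

theorem enorm_sq_add_enorm_sq_le (a b : ℝ) :
    ‖a‖ₑ ^ 2 + ‖b‖ₑ ^ 2 ≤ ‖b - a‖ₑ ^ 2 + 2 * (‖a‖ₑ * ‖b‖ₑ) := by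
  simp only [Real.enorm_eq_ofReal_abs]
  rw [← ENNReal.ofReal_pow (abs_nonneg _), ← ENNReal.ofReal_pow (abs_nonneg _),
    ← ENNReal.ofReal_pow (abs_nonneg _), ← ENNReal.ofReal_mul (abs_nonneg _),
    ← ENNReal.ofReal_add (by positivity) (by positivity),
    show (2 : ℝ≥0∞) = ENNReal.ofReal 2 by simp, ← ENNReal.ofReal_mul (by positivity),
    ← ENNReal.ofReal_add (by positivity) (by positivity)]
  refine ENNReal.ofReal_le_ofReal ?_
  rw [← abs_mul, sq_abs, sq_abs, sq_abs]
  nlinarith [le_abs_self (a * b)]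

/-- Average `a² + b² = (b - a)² + 2ab`, with `a = f x` and `b = f (x + y)`, over `|y| ≤ h`. The
difference is controlled by the gradient. The product, integrated over all `y` instead of the ball,
factors into `‖f‖₁²`. -/
theorem nash_of_contDiff {d : ℕ} {f : EuclideanSpace ℝ (Fin d) → ℝ}
    (hf : ContDiff ℝ 1 f) (hc : HasCompactSupport f) {h : ℝ} (hh : 0 < h) :
    2 * eLpNorm f 2 volume ^ 2 ≤ ENNReal.ofReal (h ^ 2) * eLpNorm (∇ f) 2 volume ^ 2 +
      2 * (volume (Metric.closedBall (0 : EuclideanSpace ℝ (Fin d)) h))⁻¹ *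
        eLpNorm f 1 volume ^ 2 := by
  set A := eLpNorm f 2 volume ^ 2 with hA
  set D := eLpNorm (∇ f) 2 volume ^ 2 with hD
  set V := volume (Metric.closedBall (0 : EuclideanSpace ℝ (Fin d)) h) with hV
  have hV0 : V ≠ 0 := (Metric.measure_closedBall_pos volume 0 hh).ne'
  have hVt : V ≠ ⊤ := measure_closedBall_lt_top.ne
  have hcont := hf.continuous
  have hm1 : Measurable fun x => ‖f x‖ₑ := hcont.measurable.enorm
  have sq : ∀ y, 2 * A ≤ ‖y‖ₑ ^ 2 * D + 2 * ∫⁻ x, ‖f x‖ₑ * ‖f (x + y)‖ₑ := by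
    intro y
    have e1 : 2 * A = ∫⁻ x, (‖f x‖ₑ ^ 2 + ‖f (x + y)‖ₑ ^ 2) := by
      rw [lintegral_add_left (hm1.pow_const 2),
        lintegral_add_right_eq_self (fun x => ‖f x‖ₑ ^ 2) y, hA, eLpNorm_two_sq, two_mul]
    have hT := lintegral_sq_translate_sub_le hf y
    rw [e1]
    calc ∫⁻ x, (‖f x‖ₑ ^ 2 + ‖f (x + y)‖ₑ ^ 2)
        ≤ ∫⁻ x, (‖f (x + y) - f x‖ₑ ^ 2 + 2 * (‖f x‖ₑ * ‖f (x + y)‖ₑ)) := by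
          exact lintegral_mono fun x => enorm_sq_add_enorm_sq_le _ _
      _ = (∫⁻ x, ‖f (x + y) - f x‖ₑ ^ 2) + 2 * ∫⁻ x, ‖f x‖ₑ * ‖f (x + y)‖ₑ := by
          rw [lintegral_add_left (by fun_prop), lintegral_const_mul' _ _ (by finiteness)]
      _ ≤ _ := by
          rw [hD, eLpNorm_two_sq]
          gcongr
  have dbl : ∫⁻ y in Metric.closedBall (0 : EuclideanSpace ℝ (Fin d)) h, ∫⁻ x, ‖f x‖ₑ * ‖f (x + y)‖ₑ ≤
      eLpNorm f 1 volume ^ 2 := by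
    refine (setLIntegral_le_lintegral _ _).trans_eq ?_
    rw [lintegral_lintegral_swap (by fun_prop), eLpNorm_one_eq_lintegral_enorm, pow_two,
      ← lintegral_mul_const' _ _ (by
        rw [← eLpNorm_one_eq_lintegral_enorm]
        exact ((hcont.memLp_of_hasCompactSupport hc).eLpNorm_lt_top).ne)]
    congr 1 with x
    rw [lintegral_const_mul' _ _ (by finiteness),
      lintegral_add_left_eq_self (fun y => ‖f y‖ₑ) x]
  have avg : V * (2 * A) ≤ V * (ENNReal.ofReal (h ^ 2) * D) + 2 * eLpNorm f 1 volume ^ 2 := by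
    calc V * (2 * A) = ∫⁻ _ in Metric.closedBall (0 : EuclideanSpace ℝ (Fin d)) h, 2 * A := by simp [hV, mul_comm]
      _ ≤ ∫⁻ y in Metric.closedBall (0 : EuclideanSpace ℝ (Fin d)) h,
          (ENNReal.ofReal (h ^ 2) * D + 2 * ∫⁻ x, ‖f x‖ₑ * ‖f (x + y)‖ₑ) := by
          refine setLIntegral_mono' measurableSet_closedBall fun y hy => (sq y).trans ?_
          gcongr
          rw [ENNReal.ofReal_pow hh.le]
          gcongr
          rw [← ofReal_norm]
          exact ENNReal.ofReal_le_ofReal (by simpa using hy)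
      _ = V * (ENNReal.ofReal (h ^ 2) * D) + 2 * ∫⁻ y in Metric.closedBall (0 : EuclideanSpace ℝ (Fin d)) h,
            ∫⁻ x, ‖f x‖ₑ * ‖f (x + y)‖ₑ := by
          rw [lintegral_add_left measurable_const, lintegral_const_mul' 2 _ (by finiteness)]
          simp [hV, mul_comm, mul_assoc]
      _ ≤ _ := by gcongr
  have := mul_le_mul_right avg V⁻¹
  rw [mul_add, ← mul_assoc, ← mul_assoc V⁻¹ V, ENNReal.inv_mul_cancel hV0 hVt, one_mul,
    one_mul] at this
  refine this.trans_eq ?_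
  ring

/-! ### Weak gradients and `H¹` limits of compactly supported functions -/

theorem hasWeakGradient_of_contDiff {d : ℕ} {Ω : Set (EuclideanSpace ℝ (Fin d))}
    {f : EuclideanSpace ℝ (Fin d) → ℝ} (hf : ContDiff ℝ 1 f) : HasWeakGradient Ω f (∇ f) := by
  have hg := continuous_gradient hf
  refine ⟨hf.continuous.locallyIntegrable.locallyIntegrableOn _,
    hg.locallyIntegrable.locallyIntegrableOn _, ?_⟩
  rintro φ ⟨hφ, hφc, hφs⟩
  have hφ1 : ContDiff ℝ 1 φ := hφ.of_le (by exact_mod_cast le_top)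
  have hφg := continuous_gradient hφ1
  have hφgc : HasCompactSupport (∇ φ) :=
    hφc.of_isClosed_subset (isClosed_tsupport _) (tsupport_gradient_subset φ)
  have i1 : Integrable fun x => f x • ∇ φ x :=
    (hf.continuous.smul hφg).integrable_of_hasCompactSupport hφgc.smul_left
  have i2 : Integrable fun x => φ x • ∇ f x :=
    (hφ1.continuous.smul hg).integrable_of_hasCompactSupport hφc.smul_right
  rw [setIntegral_eq_integral_of_forall_compl_eq_zero,
    setIntegral_eq_integral_of_forall_compl_eq_zero]
  · refine ext_inner_right ℝ fun v => ?_
    rw [inner_neg_left, real_inner_comm, ← integral_inner i1, real_inner_comm, ← integral_inner i2]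
    have c1 : ∀ x, inner ℝ v (f x • ∇ φ x) = f x * fderiv ℝ φ x v := fun x => by
      rw [inner_smul_right, real_inner_comm, inner_gradient_left (𝕜 := ℝ)]
    have c2 : ∀ x, inner ℝ v (φ x • ∇ f x) = fderiv ℝ f x v * φ x := fun x => by
      rw [inner_smul_right, real_inner_comm, inner_gradient_left (𝕜 := ℝ), mul_comm]
    have j1 := i1.const_inner (𝕜 := ℝ) v
    have j2 := i2.const_inner (𝕜 := ℝ) v
    simp only [c1, c2] at j1 j2 ⊢
    exact integral_mul_fderiv_eq_neg_fderiv_mul_of_integrable j2 j1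
      ((hf.continuous.mul hφ1.continuous).integrable_of_hasCompactSupport hφc.mul_left)
      (fun x _ => hf.differentiable one_ne_zero x) (fun x _ => hφ1.differentiable one_ne_zero x)
  · intro x hx
    rw [image_eq_zero_of_notMem_tsupport fun h => hx (hφs h), zero_smul]
  · intro x hx
    rw [image_eq_zero_of_notMem_tsupport fun h => hx (hφs (tsupport_gradient_subset φ h)),
      smul_zero]

/-- Test functions and their gradients are bounded, so `L¹` convergence suffices. This weak
requirement matters for powers, where the candidate gradient is a product of two `L²` functions. -/
theorem HasWeakGradient.of_tendsto {d : ℕ} {Ω : Set (EuclideanSpace ℝ (Fin d))}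
    {v : ℕ → EuclideanSpace ℝ (Fin d) → ℝ} {v₀ : EuclideanSpace ℝ (Fin d) → ℝ}
    {g : ℕ → EuclideanSpace ℝ (Fin d) → EuclideanSpace ℝ (Fin d)}
    {g₀ : EuclideanSpace ℝ (Fin d) → EuclideanSpace ℝ (Fin d)}
    (hvg : ∀ k, HasWeakGradient Ω (v k) (g k))
    (hv : ∀ k, IntegrableOn (v k) Ω) (hg : ∀ k, IntegrableOn (g k) Ω)
    (hv₀ : IntegrableOn v₀ Ω) (hg₀ : IntegrableOn g₀ Ω)
    (htv : Tendsto (fun k => eLpNorm (v k - v₀) 1 (volume.restrict Ω)) atTop (𝓝 0))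
    (htg : Tendsto (fun k => eLpNorm (g k - g₀) 1 (volume.restrict Ω)) atTop (𝓝 0)) :
    HasWeakGradient Ω v₀ g₀ := by
  refine ⟨hv₀.locallyIntegrableOn, hg₀.locallyIntegrableOn, ?_⟩
  rintro φ ⟨hφ, hφc, hφs⟩
  have hφ1 : ContDiff ℝ 1 φ := hφ.of_le (by exact_mod_cast le_top)
  have hφg := continuous_gradient hφ1
  have hφgc : HasCompactSupport (∇ φ) :=
    hφc.of_isClosed_subset (isClosed_tsupport _) (tsupport_gradient_subset φ)
  obtain ⟨C, hC⟩ := hφg.bounded_above_of_compact_support hφgc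
  obtain ⟨C', hC'⟩ := hφ1.continuous.bounded_above_of_compact_support hφc
  have i1 : ∀ {u : EuclideanSpace ℝ (Fin d) → ℝ}, IntegrableOn u Ω →
      IntegrableOn (fun x => u x • ∇ φ x) Ω := fun hu =>
    Integrable.mono' (hu.norm.mul_const C)
      (hu.aestronglyMeasurable.smul hφg.aestronglyMeasurable) (ae_of_all _ fun x => by
        rw [norm_smul]; exact mul_le_mul_of_nonneg_left (hC x) (norm_nonneg _))
  have i2 : ∀ {u : EuclideanSpace ℝ (Fin d) → EuclideanSpace ℝ (Fin d)}, IntegrableOn u Ω →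
      IntegrableOn (fun x => φ x • u x) Ω := fun hu =>
    Integrable.mono' (hu.norm.const_mul C')
      (hφ1.continuous.aestronglyMeasurable.smul hu.aestronglyMeasurable) (ae_of_all _ fun x => by
        rw [norm_smul]; exact mul_le_mul_of_nonneg_right (hC' x) (norm_nonneg _))
  have t1 : Tendsto (fun k => ∫ x in Ω, v k x • ∇ φ x) atTop (𝓝 (∫ x in Ω, v₀ x • ∇ φ x)) := by
    refine tendsto_integral_of_L1' _ (i1 hv₀).aestronglyMeasurable
      (Eventually.of_forall fun k => i1 (hv k)) ?_
    refine tendsto_of_tendsto_of_tendsto_of_le_of_le tendsto_const_nhds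
      (h := fun k => ENNReal.ofReal C * eLpNorm (v k - v₀) 1 (volume.restrict Ω)) ?_
      (fun _ => zero_le) fun k => ?_
    · simpa using ENNReal.Tendsto.const_mul htv (Or.inr ENNReal.ofReal_ne_top)
    · refine eLpNorm_le_mul_eLpNorm_of_ae_le_mul (ae_of_all _ fun x => ?_) 1
      simp only [Pi.sub_apply, ← sub_smul, norm_smul]
      rw [mul_comm]
      exact mul_le_mul_of_nonneg_right (hC x) (norm_nonneg _)
  have t2 : Tendsto (fun k => ∫ x in Ω, φ x • g k x) atTop (𝓝 (∫ x in Ω, φ x • g₀ x)) := by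
    refine tendsto_integral_of_L1' _ (i2 hg₀).aestronglyMeasurable
      (Eventually.of_forall fun k => i2 (hg k)) ?_
    refine tendsto_of_tendsto_of_tendsto_of_le_of_le tendsto_const_nhds
      (h := fun k => ENNReal.ofReal C' * eLpNorm (g k - g₀) 1 (volume.restrict Ω)) ?_
      (fun _ => zero_le) fun k => ?_
    · simpa using ENNReal.Tendsto.const_mul htg (Or.inr ENNReal.ofReal_ne_top)
    · refine eLpNorm_le_mul_eLpNorm_of_ae_le_mul (ae_of_all _ fun x => ?_) 1
      simp only [Pi.sub_apply, ← smul_sub, norm_smul]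
      exact mul_le_mul_of_nonneg_right (hC' x) (norm_nonneg _)
  have e : ∀ k, ∫ x in Ω, v k x • ∇ φ x = - ∫ x in Ω, φ x • g k x :=
    fun k => (hvg k).2.2 φ ⟨hφ, hφc, hφs⟩
  simp only [e] at t1
  exact tendsto_nhds_unique t1 t2.neg

theorem tendsto_eLpNorm_one_of_two {α E : Type*} [MeasurableSpace α] [NormedAddCommGroup E]
    {μ : Measure α} [IsFiniteMeasure μ] {f : ℕ → α → E} (hf : ∀ k, AEStronglyMeasurable (f k) μ)
    (h : Tendsto (fun k => eLpNorm (f k) 2 μ) atTop (𝓝 0)) :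
    Tendsto (fun k => eLpNorm (f k) 1 μ) atTop (𝓝 0) := by
  refine tendsto_of_tendsto_of_tendsto_of_le_of_le tendsto_const_nhds ?_ (fun _ => zero_le)
    fun k => eLpNorm_le_eLpNorm_mul_rpow_measure_univ one_le_two (hf k)
  have : μ univ ^ (1 / (1 : ℝ≥0∞).toReal - 1 / (2 : ℝ≥0∞).toReal) ≠ ⊤ :=
    ENNReal.rpow_ne_top_of_nonneg (by norm_num) (measure_ne_top _ _)
  simpa using ENNReal.Tendsto.mul_const h (Or.inr this)

theorem tendsto_eLpNorm_of_tendsto_sub {α E : Type*} [MeasurableSpace α] [NormedAddCommGroup E]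
    {μ : Measure α} {p : ℝ≥0∞} [hp : Fact (1 ≤ p)] {f : ℕ → α → E} {f₀ : α → E}
    (hf : ∀ k, MemLp (f k) p μ) (hf₀ : MemLp f₀ p μ)
    (h : Tendsto (fun k => eLpNorm (f k - f₀) p μ) atTop (𝓝 0)) :
    Tendsto (fun k => eLpNorm (f k) p μ) atTop (𝓝 (eLpNorm f₀ p μ)) := by
  have := ((Lp.tendsto_Lp_iff_tendsto_eLpNorm'' f hf f₀ hf₀).2 h).enorm
  simpa [Lp.enorm_toLp] using this

/-- `v` is the limit in `H¹(Ω)` of `C¹` functions with compact support in `Ω`, and `G` is its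
gradient. -/
def IsH1Limit {d : ℕ} (Ω : Set (EuclideanSpace ℝ (Fin d)))
    (v : EuclideanSpace ℝ (Fin d) → ℝ)
    (G : EuclideanSpace ℝ (Fin d) → EuclideanSpace ℝ (Fin d)) : Prop :=
  MemLp v 2 (volume.restrict Ω) ∧ MemLp G 2 (volume.restrict Ω) ∧
    ∃ ψ : ℕ → EuclideanSpace ℝ (Fin d) → ℝ,
      (∀ k, ContDiff ℝ 1 (ψ k) ∧ HasCompactSupport (ψ k) ∧ tsupport (ψ k) ⊆ Ω) ∧
      Tendsto (fun k => eLpNorm (ψ k - v) 2 (volume.restrict Ω)) atTop (𝓝 0) ∧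
      Tendsto (fun k => eLpNorm (∇ (ψ k) - G) 2 (volume.restrict Ω)) atTop (𝓝 0)

theorem MemH10.exists_isH1Limit {d : ℕ} {Ω : Set (EuclideanSpace ℝ (Fin d))}
    {u : EuclideanSpace ℝ (Fin d) → ℝ} (hu : MemH10 Ω u) : ∃ g, IsH1Limit Ω u g := by
  obtain ⟨hu, g, -, hg, φ, hφ, h1, h2⟩ := hu
  exact ⟨g, hu, hg, φ, fun k => ⟨(hφ k).1.of_le (by exact_mod_cast le_top), (hφ k).2⟩, h1, h2⟩

section

variable {d : ℕ} {Ω : Set (EuclideanSpace ℝ (Fin d))} {f : EuclideanSpace ℝ (Fin d) → ℝ}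

theorem memLp_restrict_of_contDiff (hf : ContDiff ℝ 1 f) (hc : HasCompactSupport f) (p : ℝ≥0∞) :
    MemLp f p (volume.restrict Ω) :=
  (hf.continuous.memLp_of_hasCompactSupport hc).restrict _

theorem memLp_gradient_restrict_of_contDiff (hf : ContDiff ℝ 1 f) (hc : HasCompactSupport f)
    (p : ℝ≥0∞) : MemLp (∇ f) p (volume.restrict Ω) :=
  ((continuous_gradient hf).memLp_of_hasCompactSupport
    (hc.of_isClosed_subset (isClosed_tsupport _) (tsupport_gradient_subset f))).restrict _

end

theorem IsH1Limit.hasWeakGradient {d : ℕ} {Ω : Set (EuclideanSpace ℝ (Fin d))}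
    [IsFiniteMeasure (volume.restrict Ω)] {v : EuclideanSpace ℝ (Fin d) → ℝ}
    {G : EuclideanSpace ℝ (Fin d) → EuclideanSpace ℝ (Fin d)} (h : IsH1Limit Ω v G) :
    HasWeakGradient Ω v G := by
  obtain ⟨hv, hG, ψ, hψ, h1, h2⟩ := h
  have m1 := fun k => memLp_restrict_of_contDiff (Ω := Ω) (hψ k).1 (hψ k).2.1 2
  have m2 := fun k => memLp_gradient_restrict_of_contDiff (Ω := Ω) (hψ k).1 (hψ k).2.1 2
  exact HasWeakGradient.of_tendsto (fun k => hasWeakGradient_of_contDiff (hψ k).1)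
    (fun k => (m1 k).integrable one_le_two) (fun k => (m2 k).integrable one_le_two)
    (hv.integrable one_le_two) (hG.integrable one_le_two)
    (tendsto_eLpNorm_one_of_two (fun k => ((m1 k).sub hv).aestronglyMeasurable) h1)
    (tendsto_eLpNorm_one_of_two (fun k => ((m2 k).sub hG).aestronglyMeasurable) h2)

theorem IsH1Limit.nash {d : ℕ} {Ω : Set (EuclideanSpace ℝ (Fin d))}
    [IsFiniteMeasure (volume.restrict Ω)] {v : EuclideanSpace ℝ (Fin d) → ℝ}
    {G : EuclideanSpace ℝ (Fin d) → EuclideanSpace ℝ (Fin d)} (H : IsH1Limit Ω v G)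
    {h : ℝ} (hh : 0 < h) :
    2 * eLpNorm v 2 (volume.restrict Ω) ^ 2 ≤
      ENNReal.ofReal (h ^ 2) * eLpNorm G 2 (volume.restrict Ω) ^ 2 +
      2 * (volume (Metric.closedBall (0 : EuclideanSpace ℝ (Fin d)) h))⁻¹ *
        eLpNorm v 1 (volume.restrict Ω) ^ 2 := by
  obtain ⟨hv, hG, ψ, hψ, h1, h2⟩ := H
  have m1 := fun k => memLp_restrict_of_contDiff (Ω := Ω) (hψ k).1 (hψ k).2.1
  have m2 := fun k => memLp_gradient_restrict_of_contDiff (Ω := Ω) (hψ k).1 (hψ k).2.1 2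
  have h3 := tendsto_eLpNorm_one_of_two (fun k => ((m1 k 2).sub hv).aestronglyMeasurable) h1
  have t1 := tendsto_eLpNorm_of_tendsto_sub (fun k => m1 k 2) hv h1
  have t2 := tendsto_eLpNorm_of_tendsto_sub m2 hG h2
  have t3 := tendsto_eLpNorm_of_tendsto_sub (fun k => m1 k 1) (hv.mono_exponent one_le_two) h3
  have hV : (volume (Metric.closedBall (0 : EuclideanSpace ℝ (Fin d)) h))⁻¹ ≠ ⊤ :=
    ENNReal.inv_ne_top.2 (Metric.measure_closedBall_pos volume 0 hh).ne'
  have L := ENNReal.Tendsto.const_mul (a := 2) (ENNReal.Tendsto.pow (n := 2) t1) (Or.inr (by finiteness))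
  have R := (ENNReal.Tendsto.const_mul (a := ENNReal.ofReal (h ^ 2)) (ENNReal.Tendsto.pow (n := 2) t2)
    (Or.inr (by finiteness))).add (ENNReal.Tendsto.const_mul
    (a := 2 * (volume (Metric.closedBall (0 : EuclideanSpace ℝ (Fin d)) h))⁻¹) (ENNReal.Tendsto.pow (n := 2) t3)
    (Or.inr (ENNReal.mul_ne_top (by finiteness) hV)))
  refine le_of_tendsto_of_tendsto' L R fun k => ?_
  -- The approximants vanish outside `Ω`, so norms over `Ω` are norms over the whole space.
  have s1 : Function.support (ψ k) ⊆ Ω := (subset_tsupport _).trans (hψ k).2.2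
  have s2 : Function.support (∇ (ψ k)) ⊆ Ω :=
    (subset_tsupport _).trans ((tsupport_gradient_subset _).trans (hψ k).2.2)
  rw [eLpNorm_restrict_eq_of_support_subset s1, eLpNorm_restrict_eq_of_support_subset s1,
    eLpNorm_restrict_eq_of_support_subset s2]
  exact nash_of_contDiff (hψ k).1 (hψ k).2.1 hh

theorem tendsto_eLpNorm_sub_of_dominated {α E : Type*} [MeasurableSpace α] [NormedAddCommGroup E]
    {μ : Measure α} {p : ℝ≥0∞} (hp0 : p ≠ 0) (hpt : p ≠ ⊤) {f : ℕ → α → E} {f₀ : α → E}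
    {b : α → ℝ} (hb : MemLp b p μ) (hf : ∀ k, AEStronglyMeasurable (f k) μ)
    (hf₀ : AEStronglyMeasurable f₀ μ)
    (hfb : ∀ k, ∀ᵐ x ∂μ, ‖f k x - f₀ x‖ ≤ b x)
    (ht : ∀ᵐ x ∂μ, Tendsto (fun k => f k x) atTop (𝓝 (f₀ x))) :
    Tendsto (fun k => eLpNorm (f k - f₀) p μ) atTop (𝓝 0) := by
  have hp : 0 < p.toReal := ENNReal.toReal_pos hp0 hpt
  have key : Tendsto (fun k => ∫⁻ x, ‖(f k - f₀) x‖ₑ ^ p.toReal ∂μ) atTop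
      (𝓝 (∫⁻ _, 0 ∂μ)) := by
    refine tendsto_lintegral_of_dominated_convergence' (fun x => ‖b x‖ₑ ^ p.toReal)
      (fun k => ((hf k).sub hf₀).enorm.pow_const _) (fun k => ?_)
      (lintegral_rpow_enorm_lt_top_of_eLpNorm_lt_top hp0 hpt hb.eLpNorm_lt_top).ne ?_
    · filter_upwards [hfb k] with x hx
      gcongr
      exact enorm_le_iff_norm_le.2 (hx.trans (le_abs_self _))
    · filter_upwards [ht] with x hx
      have h1 : Tendsto (fun k => f k x - f₀ x) atTop (𝓝 0) := by
        simpa using hx.sub_const (f₀ x)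
      have h2 := (ENNReal.continuous_rpow_const (y := p.toReal)).tendsto 0 |>.comp
        (by simpa using h1.enorm : Tendsto (fun k => ‖f k x - f₀ x‖ₑ) atTop (𝓝 0))
      simpa [Function.comp_def, ENNReal.zero_rpow_of_pos hp] using h2
  have h2 := (ENNReal.continuous_rpow_const (y := 1 / p.toReal)).tendsto _ |>.comp key
  simp only [lintegral_zero, ENNReal.zero_rpow_of_pos (one_div_pos.2 hp)] at h2
  refine h2.congr fun k => ?_
  simp [eLpNorm_eq_lintegral_rpow_enorm_toReal hp0 hpt]

theorem gradient_comp {d : ℕ} {F : ℝ → ℝ} {f : EuclideanSpace ℝ (Fin d) → ℝ}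
    {x : EuclideanSpace ℝ (Fin d)} (hF : DifferentiableAt ℝ F (f x))
    (hf : DifferentiableAt ℝ f x) : ∇ (F ∘ f) x = deriv F (f x) • ∇ f x := by
  rw [gradient, (hF.hasDerivAt.comp_hasFDerivAt x hf.hasFDerivAt).fderiv, gradient, map_smul]

/-- Composing the approximants with `F` keeps their supports inside `Ω` because `F 0 = 0`. This is
why approximants are only asked to be `C¹`. -/
theorem IsH1Limit.comp {d : ℕ} {Ω : Set (EuclideanSpace ℝ (Fin d))}
    {u : EuclideanSpace ℝ (Fin d) → ℝ}
    {g : EuclideanSpace ℝ (Fin d) → EuclideanSpace ℝ (Fin d)} (H : IsH1Limit Ω u g)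
    {F : ℝ → ℝ} (hF : ContDiff ℝ 1 F) (hF0 : F 0 = 0) {C : ℝ} (hC : ∀ s, ‖deriv F s‖ ≤ C) :
    IsH1Limit Ω (F ∘ u) (fun x => deriv F (u x) • g x) := by
  obtain ⟨hu, hg, ψ, hψ, h1, h2⟩ := H
  have hC0 : 0 ≤ C := (norm_nonneg _).trans (hC 0)
  have hd := hF.differentiable one_ne_zero
  have hF' : Continuous (deriv F) := hF.continuous_deriv le_rfl
  have hlip : LipschitzWith C.toNNReal F := lipschitzWith_of_nnnorm_deriv_le hd fun s => by
    rw [← NNReal.coe_le_coe]; simpa [hC0] using hC s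
  have hmd : ∀ {v : EuclideanSpace ℝ (Fin d) → ℝ}, MemLp v 2 (volume.restrict Ω) →
      AEStronglyMeasurable (fun x => deriv F (v x)) (volume.restrict Ω) := fun hv =>
    hF'.comp_aestronglyMeasurable hv.aestronglyMeasurable
  have m1 := fun k => memLp_restrict_of_contDiff (Ω := Ω) (hψ k).1 (hψ k).2.1 2
  have m2 := fun k => memLp_gradient_restrict_of_contDiff (Ω := Ω) (hψ k).1 (hψ k).2.1 2
  -- `deriv F` is merely continuous, so `deriv F (ψ k)` is handled by pointwise convergence along a
  -- subsequence.
  obtain ⟨ns, hns, hae⟩ := (tendstoInMeasure_of_tendsto_eLpNorm two_ne_zero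
    (fun k => (m1 k).aestronglyMeasurable) hu.aestronglyMeasurable h1).exists_seq_tendsto_ae
  have t1 := h1.comp hns.tendsto_atTop
  have t2 := h2.comp hns.tendsto_atTop
  have grad : ∀ k, ∇ (F ∘ ψ k) = fun x => deriv F (ψ k x) • ∇ (ψ k) x := fun k =>
    funext fun x => gradient_comp (hd _) ((hψ k).1.differentiable one_ne_zero x)
  refine ⟨hlip.comp_memLp hF0 hu, ?_, fun k => F ∘ ψ (ns k), fun k => ?_, ?_, ?_⟩
  · refine hg.of_le_mul (c := C) ((hmd hu).smul hg.aestronglyMeasurable) (ae_of_all _ fun x => ?_)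
    rw [norm_smul]
    exact mul_le_mul_of_nonneg_right (hC _) (norm_nonneg _)
  · exact ⟨hF.comp (hψ _).1, (hψ _).2.1.comp_left hF0,
      (tsupport_comp_subset hF0 _).trans (hψ _).2.2⟩
  · refine tendsto_of_tendsto_of_tendsto_of_le_of_le tendsto_const_nhds
      (h := fun k => ENNReal.ofReal C * eLpNorm (ψ (ns k) - u) 2 (volume.restrict Ω)) ?_
      (fun _ => zero_le) fun k => ?_
    · simpa using ENNReal.Tendsto.const_mul t1 (Or.inr ENNReal.ofReal_ne_top)
    · refine eLpNorm_le_mul_eLpNorm_of_ae_le_mul (ae_of_all _ fun x => ?_) 2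
      simpa [hC0] using hlip.norm_sub_le (ψ (ns k) x) (u x)
  · have t3 : Tendsto (fun k => eLpNorm ((fun x => deriv F (ψ (ns k) x) • g x) -
        fun x => deriv F (u x) • g x) 2 (volume.restrict Ω)) atTop (𝓝 0) := by
      refine tendsto_eLpNorm_sub_of_dominated two_ne_zero ENNReal.ofNat_ne_top
        (hg.norm.const_mul (2 * C)) (fun k => (hmd (m1 _)).smul hg.aestronglyMeasurable)
        ((hmd hu).smul hg.aestronglyMeasurable) (fun k => ae_of_all _ fun x => ?_) ?_
      · rw [← sub_smul, norm_smul]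
        refine mul_le_mul_of_nonneg_right ((norm_sub_le _ _).trans ?_) (norm_nonneg _)
        linarith [hC (ψ (ns k) x), hC (u x)]
      · filter_upwards [hae] with x hx
        exact ((hF'.tendsto _).comp hx).smul_const _
    refine tendsto_of_tendsto_of_tendsto_of_le_of_le tendsto_const_nhds
      (h := fun k => ENNReal.ofReal C * eLpNorm (∇ (ψ (ns k)) - g) 2 (volume.restrict Ω) +
        eLpNorm ((fun x => deriv F (ψ (ns k) x) • g x) -
        fun x => deriv F (u x) • g x) 2 (volume.restrict Ω)) ?_ (fun _ => zero_le) fun k => ?_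
    · simpa using (ENNReal.Tendsto.const_mul t2 (Or.inr ENNReal.ofReal_ne_top)).add t3
    -- The first summand is small because `∇ ψ` converges in `L²` and `deriv F` is bounded, the
    -- second by dominated convergence.
    · have e : ∇ (F ∘ ψ (ns k)) - (fun x => deriv F (u x) • g x) =
          (fun x => deriv F (ψ (ns k) x) • (∇ (ψ (ns k)) x - g x)) +
          ((fun x => deriv F (ψ (ns k) x) • g x) - fun x => deriv F (u x) • g x) := by
        ext1 x
        simp only [grad, Pi.sub_apply, Pi.add_apply, smul_sub]
        abel
      rw [e]
      refine (eLpNorm_add_le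
        ((hmd (m1 _)).smul ((m2 (ns k)).aestronglyMeasurable.sub hg.aestronglyMeasurable))
        (((hmd (m1 _)).smul hg.aestronglyMeasurable).sub
          ((hmd hu).smul hg.aestronglyMeasurable)) one_le_two).trans ?_
      refine add_le_add ?_ le_rfl
      refine eLpNorm_le_mul_eLpNorm_of_ae_le_mul (ae_of_all _ fun x => ?_) 2
      rw [Pi.smul_apply', norm_smul]
      exact mul_le_mul_of_nonneg_right (hC _) (norm_nonneg _)

/-! ### Truncated powers and Nash's inequality for powers -/

/-- A `C¹` function with bounded derivative that agrees with `s ↦ s ^ m` on `[0, N]`. -/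
def truncPow (m : ℕ) (N s : ℝ) : ℝ :=
  ∫ r in (0 : ℝ)..s, m * (min (max r 0) N) ^ (m - 1)

theorem hasDerivAt_truncPow (m : ℕ) (N s : ℝ) :
    HasDerivAt (truncPow m N) (m * (min (max s 0) N) ^ (m - 1)) s := by
  have hc : Continuous fun r : ℝ => m * (min (max r 0) N) ^ (m - 1) := by fun_prop
  exact intervalIntegral.integral_hasDerivAt_right (hc.intervalIntegrable _ _)
    (hc.stronglyMeasurableAtFilter _ _) hc.continuousAt

theorem deriv_truncPow (m : ℕ) (N : ℝ) :
    deriv (truncPow m N) = fun s => m * (min (max s 0) N) ^ (m - 1) :=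
  funext fun s => (hasDerivAt_truncPow m N s).deriv

theorem contDiff_truncPow (m : ℕ) (N : ℝ) : ContDiff ℝ 1 (truncPow m N) := by
  rw [contDiff_one_iff_deriv, deriv_truncPow]
  exact ⟨fun s => (hasDerivAt_truncPow m N s).differentiableAt, by fun_prop⟩

theorem norm_deriv_truncPow_le (m : ℕ) {N : ℝ} (hN : 0 ≤ N) (s : ℝ) :
    ‖deriv (truncPow m N) s‖ ≤ m * N ^ (m - 1) := by
  have h : 0 ≤ min (max s 0) N := le_min (le_max_right _ _) hN
  simp only [deriv_truncPow]
  rw [Real.norm_of_nonneg (by positivity)]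
  gcongr
  exact min_le_right _ _

theorem norm_deriv_truncPow_le_pow (m : ℕ) {N s : ℝ} (hN : 0 ≤ N) (hs : 0 ≤ s) :
    ‖deriv (truncPow m N) s‖ ≤ m * s ^ (m - 1) := by
  have h : 0 ≤ min (max s 0) N := le_min (le_max_right _ _) hN
  simp only [deriv_truncPow]
  rw [Real.norm_of_nonneg (by positivity)]
  gcongr
  exact (min_le_left _ _).trans (max_eq_left hs).le

theorem integral_nat_mul_pow_pred {m : ℕ} (hm : 1 ≤ m) (s : ℝ) :
    ∫ r in (0 : ℝ)..s, m * r ^ (m - 1) = s ^ m := by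
  obtain ⟨k, rfl⟩ := Nat.exists_eq_add_of_le' hm
  rw [intervalIntegral.integral_const_mul, Nat.add_sub_cancel, integral_pow]
  have : (k : ℝ) + 1 ≠ 0 := by positivity
  push_cast
  rw [zero_pow (by omega), sub_zero, mul_div_cancel₀ _ this]

theorem truncPow_eq_pow {m : ℕ} (hm : 1 ≤ m) {N s : ℝ} (hs : 0 ≤ s) (hsN : s ≤ N) :
    truncPow m N s = s ^ m := by
  rw [← integral_nat_mul_pow_pred hm, truncPow]
  refine intervalIntegral.integral_congr fun r hr => ?_
  rw [uIcc_of_le hs] at hr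
  simp only [max_eq_left hr.1, min_eq_left (hr.2.trans hsN)]

theorem truncPow_nonneg (m : ℕ) {N s : ℝ} (hN : 0 ≤ N) (hs : 0 ≤ s) : 0 ≤ truncPow m N s :=
  intervalIntegral.integral_nonneg hs fun r _ => by
    have h : 0 ≤ min (max r 0) N := le_min (le_max_right _ _) hN
    positivity

theorem truncPow_le_pow {m : ℕ} (hm : 1 ≤ m) {N s : ℝ} (hN : 0 ≤ N) (hs : 0 ≤ s) :
    truncPow m N s ≤ s ^ m := by
  rw [← integral_nat_mul_pow_pred hm, truncPow]
  refine intervalIntegral.integral_mono_on hs (Continuous.intervalIntegrable (by fun_prop) _ _)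
    (Continuous.intervalIntegrable (by fun_prop) _ _) fun r hr => ?_
  have h : 0 ≤ min (max r 0) N := le_min (le_max_right _ _) hN
  gcongr
  exact (min_le_left _ _).trans (max_eq_left hr.1).le

section

variable {d : ℕ} {Ω : Set (EuclideanSpace ℝ (Fin d))} {u : EuclideanSpace ℝ (Fin d) → ℝ}
  {g : EuclideanSpace ℝ (Fin d) → EuclideanSpace ℝ (Fin d)} {m : ℕ}

theorem IsH1Limit.truncPow (H : IsH1Limit Ω u g) (m N : ℕ) :
    IsH1Limit Ω (truncPow m N ∘ u) (fun x => deriv (BoundIter.truncPow m N) (u x) • g x) :=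
  H.comp (contDiff_truncPow m N) (by simp [BoundIter.truncPow])
    (norm_deriv_truncPow_le m N.cast_nonneg)

theorem tendsto_eLpNorm_truncPow_sub (hm : 1 ≤ m) {p : ℝ≥0∞} (hp0 : p ≠ 0) (hpt : p ≠ ⊤)
    (hu : AEStronglyMeasurable u (volume.restrict Ω))
    (hu0 : ∀ᵐ x ∂(volume.restrict Ω), 0 ≤ u x)
    (hum : MemLp (fun x => u x ^ m) p (volume.restrict Ω)) :
    Tendsto (fun N : ℕ => eLpNorm (BoundIter.truncPow m N ∘ u - fun x => u x ^ m) p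
      (volume.restrict Ω)) atTop (𝓝 0) := by
  refine tendsto_eLpNorm_sub_of_dominated hp0 hpt hum
    (fun N => (contDiff_truncPow m N).continuous.comp_aestronglyMeasurable hu)
    hum.aestronglyMeasurable (fun N => ?_) ?_
  · filter_upwards [hu0] with x hx
    have h1 := truncPow_nonneg m N.cast_nonneg hx
    have h2 := truncPow_le_pow hm N.cast_nonneg hx
    rw [Function.comp_apply, norm_sub_rev, Real.norm_of_nonneg (by linarith)]
    linarith
  · filter_upwards [hu0] with x hx
    refine tendsto_const_nhds.congr' ?_
    filter_upwards [eventually_ge_atTop ⌈u x⌉₊] with N hN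
    exact (truncPow_eq_pow hm hx (Nat.ceil_le.1 hN)).symm

variable [IsFiniteMeasure (volume.restrict Ω)]

/-- The chain rule holds for each truncation. As `N → ∞` the gradients are dominated by `m * u ^ (m
- 1) * ‖g‖`, integrable as a product of two `L²` functions. -/
theorem IsH1Limit.hasWeakGradient_pow (H : IsH1Limit Ω u g) (hm : 1 ≤ m)
    (hu0 : ∀ᵐ x ∂(volume.restrict Ω), 0 ≤ u x)
    (hum : MemLp (fun x => u x ^ m) 2 (volume.restrict Ω))
    (hum' : MemLp (fun x => u x ^ (m - 1)) 2 (volume.restrict Ω)) :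
    HasWeakGradient Ω (fun x => u x ^ m) (fun x => (m * u x ^ (m - 1)) • g x) := by
  have hu := H.1.aestronglyMeasurable
  have hgi : MemLp (fun x => (m * u x ^ (m - 1)) • g x) 1 (volume.restrict Ω) :=
    H.2.1.smul (hum'.const_mul (m : ℝ)) (hpqr := ⟨by simp [ENNReal.inv_two_add_inv_two]⟩)
  have hum1 := hum.mono_exponent (p := 1) one_le_two
  have hN := H.truncPow m
  refine HasWeakGradient.of_tendsto (fun N => (hN N).hasWeakGradient)
    (fun N => (hN N).1.integrable one_le_two) (fun N => (hN N).2.1.integrable one_le_two)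
    (memLp_one_iff_integrable.1 hum1) (memLp_one_iff_integrable.1 hgi)
    (tendsto_eLpNorm_truncPow_sub hm one_ne_zero ENNReal.one_ne_top hu hu0 hum1) ?_
  refine tendsto_eLpNorm_sub_of_dominated one_ne_zero ENNReal.one_ne_top
    (hgi.norm.const_mul 2) (fun N => (hN N).2.1.aestronglyMeasurable)
    hgi.aestronglyMeasurable (fun N => ?_) ?_
  · filter_upwards [hu0] with x hx
    refine (norm_sub_le _ _).trans ?_
    rw [two_mul]
    gcongr
    rw [norm_smul, norm_smul, Real.norm_of_nonneg (r := m * u x ^ (m - 1)) (by positivity)]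
    gcongr
    exact norm_deriv_truncPow_le_pow m N.cast_nonneg hx
  · filter_upwards [hu0] with x hx
    refine tendsto_const_nhds.congr' ?_
    filter_upwards [eventually_ge_atTop ⌈u x⌉₊] with N hN
    rw [deriv_truncPow]
    simp only [max_eq_left hx, min_eq_left (Nat.ceil_le.1 hN)]

/-- Nash's inequality for powers of nonnegative functions that vanish on the boundary. -/
theorem IsH1Limit.nash_pow (H : IsH1Limit Ω u g) (hΩ : IsOpen Ω) (hm : 1 ≤ m)
    (hu0 : ∀ᵐ x ∂(volume.restrict Ω), 0 ≤ u x)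
    (hum : MemLp (fun x => u x ^ m) 2 (volume.restrict Ω))
    (hum' : MemLp (fun x => u x ^ (m - 1)) 2 (volume.restrict Ω))
    {G : EuclideanSpace ℝ (Fin d) → EuclideanSpace ℝ (Fin d)}
    (hG : HasWeakGradient Ω (fun x => u x ^ m) G) {h : ℝ} (hh : 0 < h) :
    2 * eLpNorm (fun x => u x ^ m) 2 (volume.restrict Ω) ^ 2 ≤
      ENNReal.ofReal (h ^ 2) * eLpNorm G 2 (volume.restrict Ω) ^ 2 +
      2 * (volume (Metric.closedBall (0 : EuclideanSpace ℝ (Fin d)) h))⁻¹ *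
        eLpNorm (fun x => u x ^ m) 1 (volume.restrict Ω) ^ 2 := by
  have hae := hG.ae_eq hΩ (H.hasWeakGradient_pow hm hu0 hum hum')
  have t := tendsto_eLpNorm_of_tendsto_sub (fun N => (H.truncPow m N).1) hum
    (tendsto_eLpNorm_truncPow_sub hm two_ne_zero ENNReal.ofNat_ne_top
      H.1.aestronglyMeasurable hu0 hum)
  -- Only the left side needs a limit: the truncated function and its gradient are dominated by `u ^
  -- m` and `G`, so the right side is bounded uniformly in `N`.
  refine le_of_tendsto' (ENNReal.Tendsto.const_mul (a := 2) (ENNReal.Tendsto.pow (n := 2) t)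
    (Or.inr (by finiteness))) fun N => ((H.truncPow m N).nash hh).trans ?_
  gcongr
  · refine eLpNorm_mono_ae ?_
    filter_upwards [hae, hu0] with x hx hx0
    rw [hx, norm_smul, norm_smul, Real.norm_of_nonneg (r := m * u x ^ (m - 1)) (by positivity)]
    gcongr
    exact norm_deriv_truncPow_le_pow m N.cast_nonneg hx0
  · refine eLpNorm_mono_ae ?_
    filter_upwards [hu0] with x hx0
    rw [Function.comp_apply, Real.norm_of_nonneg (truncPow_nonneg m N.cast_nonneg hx0),
      Real.norm_of_nonneg (by positivity)]
    exact truncPow_le_pow hm N.cast_nonneg hx0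

end

/-! ### Real-valued integrals and one step of the iteration -/

theorem ofReal_integral_norm_sq {α E : Type*} [MeasurableSpace α] [NormedAddCommGroup E]
    {μ : Measure α} {f : α → E} (hf : MemLp f 2 μ) :
    ENNReal.ofReal (∫ x, ‖f x‖ ^ 2 ∂μ) = eLpNorm f 2 μ ^ 2 := by
  rw [ofReal_integral_eq_lintegral_ofReal (by simpa using hf.integrable_norm_pow two_ne_zero)
    (ae_of_all _ fun x => by positivity), eLpNorm_two_sq]
  refine lintegral_congr fun x => ?_
  rw [ENNReal.ofReal_pow (norm_nonneg _), ofReal_norm]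

theorem integral_norm_sq_eq_norm_sq {α E : Type*} [MeasurableSpace α] [NormedAddCommGroup E]
    {μ : Measure α} (U : Lp E 2 μ) {f : α → E} (h : U =ᵐ[μ] f) :
    ∫ x, ‖f x‖ ^ 2 ∂μ = ‖U‖ ^ 2 := by
  have hf : MemLp f 2 μ := (Lp.memLp U).ae_eq h
  rw [← ENNReal.toReal_ofReal (r := ∫ x, ‖f x‖ ^ 2 ∂μ)
    (integral_nonneg fun x => by positivity), ofReal_integral_norm_sq hf, ENNReal.toReal_pow,
    Lp.norm_def, eLpNorm_congr_ae h]

section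

variable {d : ℕ} {Ω : Set (EuclideanSpace ℝ (Fin d))}

/-- The volume of the unit ball. -/
def unitBallVolume (d : ℕ) : ℝ := volume.real (Metric.ball (0 : EuclideanSpace ℝ (Fin d)) 1)

theorem unitBallVolume_pos (d : ℕ) : 0 < unitBallVolume d :=
  ENNReal.toReal_pos (Metric.measure_ball_pos volume _ one_pos).ne' measure_ball_lt_top.ne

theorem HasWeakGradient.weakGradient {u : EuclideanSpace ℝ (Fin d) → ℝ}
    {g : EuclideanSpace ℝ (Fin d) → EuclideanSpace ℝ (Fin d)} (h : HasWeakGradient Ω u g) :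
    HasWeakGradient Ω u (weakGradient Ω u) := by
  have hex : ∃ g, HasWeakGradient Ω u g := ⟨g, h⟩
  rw [BoundIter.weakGradient, dif_pos hex]
  exact hex.choose_spec

theorem le_of_ofReal_le {a b c p v : ℝ} (hp : 0 ≤ p) (hv : 0 ≤ v) (hb : 0 ≤ b) (hc : 0 ≤ c)
    (h : 2 * ENNReal.ofReal a ≤ ENNReal.ofReal p * ENNReal.ofReal b +
      2 * ENNReal.ofReal v * ENNReal.ofReal c ^ 2) : 2 * a ≤ p * b + 2 * v * c ^ 2 := by
  rw [show (2 : ℝ≥0∞) = ENNReal.ofReal 2 by simp, ← ENNReal.ofReal_pow hc,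
    ← ENNReal.ofReal_mul (by positivity), ← ENNReal.ofReal_mul (by positivity),
    ← ENNReal.ofReal_mul (by positivity), ← ENNReal.ofReal_mul (by positivity),
    ← ENNReal.ofReal_add (by positivity) (by positivity),
    ENNReal.ofReal_le_ofReal_iff (by positivity)] at h
  exact h

theorem MemH10.integral_pow_le [IsFiniteMeasure (volume.restrict Ω)] (hΩ : IsOpen Ω)
    {u : EuclideanSpace ℝ (Fin d) → ℝ} (H : MemH10 Ω u) {m : ℕ} (hm : 1 ≤ m)
    (hu0 : ∀ᵐ x ∂(volume.restrict Ω), 0 ≤ u x)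
    (hum : MemLp (fun x => u x ^ m) 2 (volume.restrict Ω))
    (hum' : MemLp (fun x => u x ^ (m - 1)) 2 (volume.restrict Ω))
    {G : EuclideanSpace ℝ (Fin d) → EuclideanSpace ℝ (Fin d)}
    (hG : HasWeakGradient Ω (fun x => u x ^ m) G) (hG2 : MemLp G 2 (volume.restrict Ω))
    {h : ℝ} (hh : 0 < h) :
    2 * ∫ x in Ω, u x ^ (2 * m) ≤ h ^ 2 * (∫ x in Ω, ‖G x‖ ^ 2) +
      2 * (h ^ d * unitBallVolume d)⁻¹ * (∫ x in Ω, u x ^ m) ^ 2 := by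
  obtain ⟨g, hg⟩ := H.exists_isH1Limit
  have key := hg.nash_pow hΩ hm hu0 hum hum' hG hh
  have hV : volume (Metric.closedBall (0 : EuclideanSpace ℝ (Fin d)) h) =
      ENNReal.ofReal (h ^ d * unitBallVolume d) := by
    rw [Measure.addHaar_closedBall _ _ hh.le, ENNReal.ofReal_mul (by positivity),
      unitBallVolume, measureReal_def, ENNReal.ofReal_toReal measure_ball_lt_top.ne,
      finrank_euclideanSpace_fin]
  have hVp : 0 < h ^ d * unitBallVolume d := mul_pos (pow_pos hh _) (unitBallVolume_pos d)
  have e1 : ∫ x in Ω, u x ^ (2 * m) = ∫ x in Ω, ‖u x ^ m‖ ^ 2 := by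
    simp only [Real.norm_eq_abs, sq_abs, pow_mul']
  have e2 : ENNReal.ofReal (∫ x in Ω, u x ^ m) =
      eLpNorm (fun x => u x ^ m) 1 (volume.restrict Ω) := by
    rw [eLpNorm_one_eq_lintegral_enorm,
      ← ofReal_integral_norm_eq_lintegral_enorm (hum.integrable one_le_two)]
    congr 1
    refine integral_congr_ae ?_
    filter_upwards [hu0] with x hx
    rw [Real.norm_of_nonneg (by positivity)]
  have hI : 0 ≤ ∫ x in Ω, u x ^ m := integral_nonneg_of_ae (by
    filter_upwards [hu0] with x hx
    exact pow_nonneg hx m)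
  have hGI : 0 ≤ ∫ x in Ω, ‖G x‖ ^ 2 := integral_nonneg fun x => by positivity
  rw [← ofReal_integral_norm_sq hum, ← ofReal_integral_norm_sq hG2, ← e2, hV,
    ← ENNReal.ofReal_inv_of_pos hVp] at key
  rw [e1]
  exact le_of_ofReal_le (by positivity) (by positivity) hGI hI key

theorem MemC0L2.memLp {T : ℝ} {u : ℝ → EuclideanSpace ℝ (Fin d) → ℝ} (h : MemC0L2 Ω T u)
    {t : ℝ} (ht : t ∈ Icc 0 T) : MemLp (u t) 2 (volume.restrict Ω) := by
  obtain ⟨U, -, hU⟩ := h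
  exact (Lp.memLp (U t)).ae_eq (hU t ht)

theorem MemC0L2.intervalIntegrable {T : ℝ} (hT : 0 ≤ T)
    {u : ℝ → EuclideanSpace ℝ (Fin d) → ℝ} (h : MemC0L2 Ω T u) :
    IntervalIntegrable (fun s => ∫ x in Ω, u s x ^ 2) volume 0 T := by
  obtain ⟨U, hc, hU⟩ := h
  refine ContinuousOn.intervalIntegrable ?_
  rw [uIcc_of_le hT]
  refine (hc.norm.pow 2).congr fun s hs => ?_
  change _ = ‖U s‖ ^ 2
  simp [← integral_norm_sq_eq_norm_sq (U s) (hU s hs)]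

theorem MemL2H1.ae_weakGradient {T : ℝ} {u : ℝ → EuclideanSpace ℝ (Fin d) → ℝ}
    (hΩ : IsOpen Ω) (h : MemL2H1 Ω T u) :
    ∀ᵐ s ∂(volume.restrict (Ioo 0 T)), HasWeakGradient Ω (u s) (weakGradient Ω (u s)) ∧
      MemLp (weakGradient Ω (u s)) 2 (volume.restrict Ω) := by
  obtain ⟨U, G, -, -, hae⟩ := h
  filter_upwards [hae] with s hs
  exact ⟨hs.2.weakGradient, (Lp.memLp (G s)).ae_eq (hs.2.ae_eq hΩ hs.2.weakGradient)⟩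

theorem MemL2H1.intervalIntegrable {T : ℝ} (hT : 0 ≤ T)
    {u : ℝ → EuclideanSpace ℝ (Fin d) → ℝ} (hΩ : IsOpen Ω) (h : MemL2H1 Ω T u) :
    IntervalIntegrable (fun s => ∫ x in Ω, ‖weakGradient Ω (u s) x‖ ^ 2) volume 0 T := by
  obtain ⟨U, G, -, hG, hae⟩ := h
  rw [intervalIntegrable_iff_integrableOn_Ioo_of_le hT]
  refine (hG.integrable_norm_pow two_ne_zero).congr ?_
  filter_upwards [hae] with s hs
  exact (integral_norm_sq_eq_norm_sq (G s) (hs.2.ae_eq hΩ hs.2.weakGradient)).symm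

/-- The condition `b * h ^ 2 ≤ 2 * a` lets the dissipation absorb the gradient part of Nash's
inequality. The `L¹` part is at most `B ^ 2`, and its time integral against `exp s` is at most `exp
t` times a constant. The bound is assumed for almost every time but obtained for every positive
time, as the energy inequality holds at each `t`. -/
theorem integral_pow_step [IsFiniteMeasure (volume.restrict Ω)] (hΩ : IsOpen Ω) {n : ℕ}
    {w : Fin n → ℝ → EuclideanSpace ℝ (Fin d) → ℝ} {m : ℕ} (hm : 1 ≤ m)
    (hH1 : ∀ i, ∀ T : ℝ, 0 < T → MemL2H1 Ω T (fun t x => w i t x ^ m))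
    (hC0 : ∀ i, ∀ T : ℝ, 0 < T → MemC0L2 Ω T (fun t x => w i t x ^ m))
    (hLp : ∀ i, ∀ t : ℝ, 0 ≤ t → MemLp (fun x => w i t x ^ (m - 1)) 2 (volume.restrict Ω))
    (hw0 : ∀ i, ∀ t : ℝ, 0 ≤ t → ∀ᵐ x ∂(volume.restrict Ω), 0 ≤ w i t x)
    (hH10 : ∀ i, ∀ᵐ t ∂(volume.restrict (Ioi (0 : ℝ))), MemH10 Ω (w i t))
    {a b c : ℝ} (hb : 0 ≤ b)
    (hineq : ∀ t : ℝ, 0 < t →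
      (∫ x in Ω, Real.exp t * ∑ i, w i t x ^ (2 * m)) +
        a * (∫ s in (0 : ℝ)..t, ∫ x in Ω, Real.exp s *
          ∑ i, ‖weakGradient Ω (fun y => w i s y ^ m) x‖ ^ 2) ≤
      b * (∫ s in (0 : ℝ)..t, ∫ x in Ω, Real.exp s * ∑ i, w i s x ^ (2 * m)) +
        c * Real.exp t)
    {h : ℝ} (hh : 0 < h) (hab : b * h ^ 2 ≤ 2 * a) {B : ℝ}
    (hB : ∀ᵐ t ∂(volume.restrict (Ioi (0 : ℝ))), ∑ i, ∫ x in Ω, w i t x ^ m ≤ B)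
    {t : ℝ} (ht : 0 < t) :
    ∑ i, ∫ x in Ω, w i t x ^ (2 * m) ≤ b * (h ^ d * unitBallVolume d)⁻¹ * B ^ 2 + c := by
  have hVp : 0 < h ^ d * unitBallVolume d := mul_pos (pow_pos hh _) (unitBallVolume_pos d)
  set κ := b * (h ^ d * unitBallVolume d)⁻¹ with hκ
  have hκ0 : 0 ≤ κ := by positivity
  have hLpm : ∀ i, ∀ s, 0 ≤ s → MemLp (fun x => w i s x ^ m) 2 (volume.restrict Ω) :=
    fun i s hs => (hC0 i (s + 1) (by linarith)).memLp ⟨hs, by linarith⟩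
  have hint : ∀ i, ∀ s, 0 ≤ s → IntegrableOn (fun x => w i s x ^ (2 * m)) Ω := fun i s hs => by
    simp only [pow_mul']
    exact (hLpm i s hs).integrable_sq
  have eA : ∀ s, 0 ≤ s → ∫ x in Ω, Real.exp s * ∑ i, w i s x ^ (2 * m) =
      Real.exp s * ∑ i, ∫ x in Ω, w i s x ^ (2 * m) := fun s hs => by
    rw [integral_const_mul, integral_finsetSum _ fun i _ => hint i s hs]
  have hgr : ∀ᵐ s ∂(volume.restrict (Ioo 0 t)), ∀ i,
      HasWeakGradient Ω (fun y => w i s y ^ m) (weakGradient Ω (fun y => w i s y ^ m)) ∧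
      MemLp (weakGradient Ω (fun y => w i s y ^ m)) 2 (volume.restrict Ω) :=
    ae_all_iff.2 fun i => (hH1 i t ht).ae_weakGradient hΩ
  have eD : ∀ᵐ s ∂(volume.restrict (Ioo 0 t)), ∫ x in Ω, Real.exp s *
        ∑ i, ‖weakGradient Ω (fun y => w i s y ^ m) x‖ ^ 2 =
      Real.exp s * ∑ i, ∫ x in Ω, ‖weakGradient Ω (fun y => w i s y ^ m) x‖ ^ 2 := by
    filter_upwards [hgr] with s hs
    rw [integral_const_mul, integral_finsetSum _ fun i _ => by
      simpa using (hs i).2.integrable_norm_pow two_ne_zero]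
  -- Integrability in time has to be shown for both integrands: a non-integrable one would have
  -- integral `0`, and the pointwise comparison would not carry over.
  have IA : IntervalIntegrable (fun s => ∫ x in Ω, Real.exp s * ∑ i, w i s x ^ (2 * m))
      volume 0 t := by
    have h1 : IntervalIntegrable (fun s => Real.exp s * ∑ i, ∫ x in Ω, (w i s x ^ m) ^ 2)
        volume 0 t :=
      IntervalIntegrable.continuousOn_mul (by
        simpa only [Finset.sum_fn] using IntervalIntegrable.sum Finset.univ fun i _ =>
          (hC0 i t ht).intervalIntegrable ht.le) Real.continuous_exp.continuousOn
    refine h1.congr fun s hs => ?_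
    rw [uIoc_of_le ht.le] at hs
    simp only [← pow_mul']
    exact (eA s hs.1.le).symm
  have ID : IntervalIntegrable (fun s => ∫ x in Ω, Real.exp s *
      ∑ i, ‖weakGradient Ω (fun y => w i s y ^ m) x‖ ^ 2) volume 0 t := by
    have h1 : IntervalIntegrable (fun s => Real.exp s *
        ∑ i, ∫ x in Ω, ‖weakGradient Ω (fun y => w i s y ^ m) x‖ ^ 2) volume 0 t :=
      IntervalIntegrable.continuousOn_mul (by
        simpa only [Finset.sum_fn] using IntervalIntegrable.sum Finset.univ fun i _ =>
          (hH1 i t ht).intervalIntegrable ht.le hΩ) Real.continuous_exp.continuousOn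
    rw [intervalIntegrable_iff_integrableOn_Ioo_of_le ht.le] at h1 ⊢
    exact h1.congr (eD.mono fun s hs => hs.symm)
  have hpt : ∀ᵐ s ∂(volume.restrict (Ioo 0 t)),
      b * (∫ x in Ω, Real.exp s * ∑ i, w i s x ^ (2 * m)) ≤
      a * (∫ x in Ω, Real.exp s *
        ∑ i, ‖weakGradient Ω (fun y => w i s y ^ m) x‖ ^ 2) + κ * B ^ 2 * Real.exp s := by
    have hsub : Ioo 0 t ⊆ Ioi 0 := Ioo_subset_Ioi_self
    filter_upwards [hgr, eD, ae_restrict_of_ae_restrict_of_subset hsub hB,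
      ae_restrict_of_ae_restrict_of_subset hsub (ae_all_iff.2 hH10),
      ae_restrict_mem measurableSet_Ioo] with s hs heD hBs hH10s hst
    have hs0 := hst.1.le
    rw [eA s hs0, heD]
    have hI0 : ∀ i, 0 ≤ ∫ x in Ω, w i s x ^ m := fun i => integral_nonneg_of_ae (by
      filter_upwards [hw0 i s hs0] with x hx
      exact pow_nonneg hx m)
    have h1 : ∑ i, 2 * ∫ x in Ω, w i s x ^ (2 * m) ≤ ∑ i, (h ^ 2 *
        (∫ x in Ω, ‖weakGradient Ω (fun y => w i s y ^ m) x‖ ^ 2) +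
        2 * (h ^ d * unitBallVolume d)⁻¹ * (∫ x in Ω, w i s x ^ m) ^ 2) :=
      Finset.sum_le_sum fun i _ => (hH10s i).integral_pow_le hΩ hm (hw0 i s hs0) (hLpm i s hs0)
        (hLp i s hs0) (hs i).1 (hs i).2 hh
    rw [Finset.sum_add_distrib, ← Finset.mul_sum, ← Finset.mul_sum, ← Finset.mul_sum] at h1
    -- Bounding the sum of squares by the square of the sum keeps the constants independent of `n`.
    have h2 : ∑ i, (∫ x in Ω, w i s x ^ m) ^ 2 ≤ B ^ 2 :=
      (Finset.sum_sq_le_sq_sum_of_nonneg fun i _ => hI0 i).trans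
        (pow_le_pow_left₀ (Finset.sum_nonneg fun i _ => hI0 i) hBs 2)
    have hD0 : 0 ≤ ∑ i, ∫ x in Ω, ‖weakGradient Ω (fun y => w i s y ^ m) x‖ ^ 2 :=
      Finset.sum_nonneg fun i _ => integral_nonneg fun x => by positivity
    have h3 := mul_le_mul_of_nonneg_left h1 hb
    have h4 := mul_le_mul_of_nonneg_right hab hD0
    have h5 := mul_le_mul_of_nonneg_left h2 hκ0
    have h6 : b * ∑ i, ∫ x in Ω, w i s x ^ (2 * m) ≤
        a * ∑ i, (∫ x in Ω, ‖weakGradient Ω (fun y => w i s y ^ m) x‖ ^ 2) + κ * B ^ 2 := by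
      rw [hκ] at h5 ⊢
      linarith
    have h7 := mul_le_mul_of_nonneg_left h6 (Real.exp_pos s).le
    linarith
  have hmono : b * (∫ s in (0 : ℝ)..t, ∫ x in Ω, Real.exp s * ∑ i, w i s x ^ (2 * m)) ≤
      a * (∫ s in (0 : ℝ)..t, ∫ x in Ω, Real.exp s *
        ∑ i, ‖weakGradient Ω (fun y => w i s y ^ m) x‖ ^ 2) +
      κ * B ^ 2 * (Real.exp t - 1) := by
    have IE : IntervalIntegrable (fun s => κ * B ^ 2 * Real.exp s) volume 0 t :=
      Continuous.intervalIntegrable (by fun_prop) _ _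
    have e := integral_exp (a := 0) (b := t)
    rw [Real.exp_zero] at e
    rw [← e, ← intervalIntegral.integral_const_mul, ← intervalIntegral.integral_const_mul,
      ← intervalIntegral.integral_const_mul,
      ← intervalIntegral.integral_add (ID.const_mul a) IE]
    refine intervalIntegral.integral_mono_ae_restrict ht.le (IA.const_mul b)
      ((ID.const_mul a).add IE) ?_
    rw [← Measure.restrict_congr_set Ioo_ae_eq_Icc]
    exact hpt
  have hfin := hineq t ht
  rw [eA t ht.le] at hfin
  have hX : Real.exp t * ∑ i, ∫ x in Ω, w i t x ^ (2 * m) ≤ Real.exp t * (κ * B ^ 2 + c) := by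
    have : 0 ≤ κ * B ^ 2 := by positivity
    linarith
  exact le_of_mul_le_mul_left hX (Real.exp_pos t)

end

/-! ### From moments to a pointwise bound, and the numerical recursion -/

/-- By Markov's inequality, for `Y > X` the set `{Y ≤ f}` has measure at most `(X / Y) ^ 2 ^ (k +
1)`, which tends to `0`. -/
theorem ae_le_of_integral_two_pow_le {α : Type*} [MeasurableSpace α] {μ : Measure α}
    [IsFiniteMeasure μ] {f : α → ℝ} (hf0 : ∀ᵐ x ∂μ, 0 ≤ f x) {X : ℝ} (hX : 0 < X)
    (hint : ∀ k : ℕ, Integrable (fun x => f x ^ 2 ^ (k + 1)) μ)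
    (hle : ∀ k : ℕ, ∫ x, f x ^ 2 ^ (k + 1) ∂μ ≤ X ^ 2 ^ (k + 1)) : ∀ᵐ x ∂μ, f x ≤ X := by
  have key : ∀ Y, X < Y → ∀ᵐ x ∂μ, f x < Y := by
    intro Y hY
    have hY0 : 0 < Y := hX.trans hY
    have hb : ∀ k : ℕ, μ.real {x | Y ≤ f x} ≤ (X / Y) ^ 2 ^ (k + 1) := by
      intro k
      have hc := mul_meas_ge_le_integral_of_nonneg (f := fun x => f x ^ 2 ^ (k + 1))
        (by filter_upwards [hf0] with x hx using pow_nonneg hx _) (hint k) (Y ^ 2 ^ (k + 1))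
      have hs : μ.real {x | Y ≤ f x} ≤ μ.real {x | Y ^ 2 ^ (k + 1) ≤ f x ^ 2 ^ (k + 1)} :=
        measureReal_mono fun x hx => pow_le_pow_left₀ hY0.le hx _
      rw [div_pow, le_div_iff₀ (by positivity), mul_comm]
      exact (mul_le_mul_of_nonneg_left hs (by positivity)).trans (hc.trans (hle k))
    have ht : Tendsto (fun k : ℕ => (X / Y) ^ 2 ^ (k + 1)) atTop (𝓝 0) :=
      (tendsto_pow_atTop_nhds_zero_of_lt_one (by positivity) ((div_lt_one hY0).2 hY)).comp
        ((tendsto_pow_atTop_atTop_of_one_lt one_lt_two).comp (tendsto_add_atTop_nat 1))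
    have h0 : μ.real {x | Y ≤ f x} = 0 :=
      le_antisymm (ge_of_tendsto' ht hb) measureReal_nonneg
    rw [measureReal_eq_zero_iff] at h0
    simpa [ae_iff] using h0
  have h2 : ∀ᵐ x ∂μ, ∀ n : ℕ, f x < X + 1 / ((n : ℝ) + 1) :=
    ae_all_iff.2 fun n => key _ (by linarith [Nat.one_div_pos_of_nat (α := ℝ) (n := n)])
  filter_upwards [h2] with x hx
  have ht : Tendsto (fun n : ℕ => X + 1 / ((n : ℝ) + 1)) atTop (𝓝 X) := by
    simpa using (tendsto_one_div_add_atTop_nhds_zero_nat (𝕜 := ℝ)).const_add X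
  exact ge_of_tendsto' ht fun n => (hx n).le

/-- Radii for which the constants of the iteration grow at most polynomially in `q`. -/
theorem exists_iteration_constants (d : ℕ) {α β K₀ K₁ K₂ V : ℝ} (hK₀ : 0 < K₀) (hK₁ : 0 < K₁)
    (hK₂ : 0 < K₂) (hV : 0 < V) : ∃ C : ℝ, 1 ≤ C ∧ ∃ P : ℕ, ∀ q : ℕ, 1 ≤ q → ∃ h : ℝ, 0 < h ∧
      K₁ * (q : ℝ) ^ α * h ^ 2 ≤ 2 * K₀ ∧ ∀ B : ℝ, 1 ≤ B →
        K₁ * (q : ℝ) ^ α * (h ^ d * V)⁻¹ * B ^ 2 + K₂ * (q : ℝ) ^ β ≤ C * (q : ℝ) ^ P * B ^ 2 := by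
  set p := ⌈α⌉₊
  set r := ⌈β⌉₊
  set e := √(2 * K₀ / K₁)
  have he : 0 < e := Real.sqrt_pos.2 (by positivity)
  have he2 : K₁ * e ^ 2 = 2 * K₀ := by
    rw [Real.sq_sqrt (by positivity)]
    field_simp
  -- In the exponent, `p` pays for `q ^ α`, `p * d` for the factor `h⁻ᵈ` with `h = e / q ^ p`, and
  -- `r` for `q ^ β`.
  refine ⟨max 1 (K₁ * (e ^ d * V)⁻¹ + K₂), le_max_left _ _, p * (d + 1) + r, fun q hq => ?_⟩
  have hq1 : (1 : ℝ) ≤ q := by exact_mod_cast hq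
  have hq0 : (0 : ℝ) < q := by linarith
  have hqα : (q : ℝ) ^ α ≤ (q : ℝ) ^ p := by
    rw [← Real.rpow_natCast]
    exact Real.rpow_le_rpow_of_exponent_le hq1 (Nat.le_ceil _)
  have hqβ : (q : ℝ) ^ β ≤ (q : ℝ) ^ r := by
    rw [← Real.rpow_natCast]
    exact Real.rpow_le_rpow_of_exponent_le hq1 (Nat.le_ceil _)
  refine ⟨e / (q : ℝ) ^ p, by positivity, ?_, fun B hB => ?_⟩
  · rw [div_pow, ← mul_div_assoc, div_le_iff₀ (by positivity), ← he2]
    have h1 : (q : ℝ) ^ α ≤ ((q : ℝ) ^ p) ^ 2 :=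
      hqα.trans (le_self_pow₀ (one_le_pow₀ hq1) two_ne_zero)
    calc K₁ * (q : ℝ) ^ α * e ^ 2 = K₁ * e ^ 2 * (q : ℝ) ^ α := by ring
      _ ≤ _ := by gcongr
  · have hB2 : 1 ≤ B ^ 2 := one_le_pow₀ hB
    have h1 : K₁ * (q : ℝ) ^ α * ((e / (q : ℝ) ^ p) ^ d * V)⁻¹ ≤
        K₁ * (e ^ d * V)⁻¹ * (q : ℝ) ^ (p * (d + 1) + r) := by
      calc K₁ * (q : ℝ) ^ α * ((e / (q : ℝ) ^ p) ^ d * V)⁻¹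
          ≤ K₁ * (q : ℝ) ^ p * ((e / (q : ℝ) ^ p) ^ d * V)⁻¹ := by gcongr
        _ = K₁ * (e ^ d * V)⁻¹ * (q : ℝ) ^ (p * (d + 1)) := by
          rw [div_pow, ← pow_mul, mul_add, pow_add, mul_one]
          field_simp
        _ ≤ _ := by gcongr; exact Nat.le_add_right _ _
    have h2 : K₂ * (q : ℝ) ^ β ≤ K₂ * (q : ℝ) ^ (p * (d + 1) + r) := by
      refine mul_le_mul_of_nonneg_left (hqβ.trans ?_) hK₂.le
      exact pow_le_pow_right₀ hq1 (Nat.le_add_left _ _)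
    calc _ ≤ K₁ * (e ^ d * V)⁻¹ * (q : ℝ) ^ (p * (d + 1) + r) * B ^ 2 +
          K₂ * (q : ℝ) ^ (p * (d + 1) + r) * B ^ 2 :=
          add_le_add (mul_le_mul_of_nonneg_right h1 (by positivity))
            (h2.trans (le_mul_of_one_le_right (by positivity) hB2))
      _ = (K₁ * (e ^ d * V)⁻¹ + K₂) * (q : ℝ) ^ (p * (d + 1) + r) * B ^ 2 := by ring
      _ ≤ _ := by gcongr; exact le_max_right _ _

/-- An explicit supersolution of the recursion `b (k + 1) = D * R ^ k * b k ^ 2`. -/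
def iterBound (D R Y : ℝ) (k : ℕ) : ℝ := (D * R * Y) ^ 2 ^ k / (D * R * R ^ k)

theorem iterBound_zero {D R Y : ℝ} (hD : 1 ≤ D) (hR : 1 ≤ R) : iterBound D R Y 0 = Y := by
  have : D * R ≠ 0 := by positivity
  rw [iterBound, pow_zero, pow_one, pow_zero, mul_one, mul_div_cancel_left₀ _ this]

/-- Needed so that the additive term `K₂ * q ^ β` can be absorbed into a multiple of `B ^ 2` at
every step. -/
theorem one_le_iterBound {D R Y : ℝ} (hD : 1 ≤ D) (hR : 1 ≤ R) (hY : 1 ≤ Y) (k : ℕ) :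
    1 ≤ iterBound D R Y k := by
  have hA : 1 ≤ D * R := one_le_mul_of_one_le_of_one_le hD hR
  have hRA : R ≤ D * R := le_mul_of_one_le_left (by linarith) hD
  have hAX : D * R ≤ D * R * Y := le_mul_of_one_le_right (by linarith) hY
  rw [iterBound, one_le_div (by positivity)]
  calc D * R * R ^ k ≤ D * R * (D * R) ^ k := by gcongr
    _ = (D * R) ^ (k + 1) := (pow_succ' _ _).symm
    _ ≤ (D * R) ^ 2 ^ k := pow_le_pow_right₀ hA Nat.lt_two_pow_self
    _ ≤ _ := by gcongr

theorem iterBound_succ {D R Y : ℝ} (hD : 1 ≤ D) (hR : 1 ≤ R) (k : ℕ) :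
    D * R ^ k * iterBound D R Y k ^ 2 = iterBound D R Y (k + 1) := by
  rw [iterBound, iterBound, div_pow, ← pow_mul, ← pow_succ]
  field_simp
  ring

theorem iterBound_le {D R Y : ℝ} (hD : 1 ≤ D) (hR : 1 ≤ R) (hY : 1 ≤ Y) (k : ℕ) :
    iterBound D R Y k ≤ (D * R * Y) ^ 2 ^ k :=
  div_le_self (by positivity)
    (one_le_mul_of_one_le_of_one_le (one_le_mul_of_one_le_of_one_le hD hR) (one_le_pow₀ hR))

theorem rpow_two_mul_div_two (x : ℝ) (m : ℕ) : x ^ (((2 * m : ℕ) : ℝ) / 2) = x ^ m := by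
  rw [Nat.cast_mul, Nat.cast_ofNat, mul_div_cancel_left₀ _ two_ne_zero, Real.rpow_natCast]

theorem sum_integral_le_toReal_sum_norm {d n : ℕ} {Ω : Set (EuclideanSpace ℝ (Fin d))}
    {w : Fin n → ℝ → EuclideanSpace ℝ (Fin d) → ℝ}
    (hw : ∀ i, ∀ t : ℝ, 0 ≤ t → IntegrableOn (w i t) Ω)
    (hS : ∑ i, normLinftyL1 Ω (w i) ≠ ⊤) :
    ∀ᵐ t ∂(volume.restrict (Ioi (0 : ℝ))),
      ∑ i, ∫ x in Ω, w i t x ≤ (∑ i, normLinftyL1 Ω (w i)).toReal := by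
  have h : ∀ᵐ t ∂(volume.restrict (Ioi (0 : ℝ))), ∀ i,
      eLpNorm (w i t) 1 (volume.restrict Ω) ≤ normLinftyL1 Ω (w i) :=
    ae_all_iff.2 fun i => ENNReal.ae_le_essSup _
  filter_upwards [h, ae_restrict_mem measurableSet_Ioi] with t ht ht0
  rw [ENNReal.toReal_sum fun i hi => ENNReal.sum_ne_top.1 hS i hi]
  refine Finset.sum_le_sum fun i hi => ?_
  rw [← ENNReal.ofReal_le_iff_le_toReal (ENNReal.sum_ne_top.1 hS i hi)]
  refine le_trans ?_ (ht i)
  rw [eLpNorm_one_eq_lintegral_enorm,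
    ← ofReal_integral_norm_eq_lintegral_enorm (hw i t (le_of_lt ht0))]
  exact ENNReal.ofReal_le_ofReal ((Real.le_norm_self _).trans (norm_integral_le_integral_norm _))

end BoundIter

end

/-! ### The iteration -/

theorem lemmaA1 (d : ℕ) (hd : 1 ≤ d) (Ω : Set (EuclideanSpace ℝ (Fin d)))
    (hΩo : IsOpen Ω) (hΩc : IsConnected Ω) (hΩb : Bornology.IsBounded Ω)
    (α β K₀ K₁ K₂ : ℝ) (hα : 0 ≤ α) (hβ : 0 ≤ β) (hK₀ : 0 < K₀) (hK₁ : 0 < K₁) (hK₂ : 0 < K₂) :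
    ∃ K₃ : ℝ, 0 < K₃ ∧
      ∀ (n : ℕ) (w : Fin n → ℝ → EuclideanSpace ℝ (Fin d) → ℝ),
        -- regularity of the powers
        (∀ i, ∀ q : ℕ, 2 ≤ q → ∀ T : ℝ, 0 < T →
          BoundIter.MemL2H1 Ω T (fun t x => w i t x ^ ((q : ℝ) / 2)) ∧
          BoundIter.MemC0L2 Ω T (fun t x => w i t x ^ ((q : ℝ) / 2))) →
        -- nonnegativity
        (∀ i, ∀ t : ℝ, 0 ≤ t → ∀ᵐ x ∂(volume.restrict Ω), 0 ≤ w i t x) →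
        -- zero boundary values
        (∀ i, ∀ᵐ t ∂(volume.restrict (Ioi (0 : ℝ))), BoundIter.MemH10 Ω (w i t)) →
        -- zero initial values
        (∀ i, ∀ᵐ x ∂(volume.restrict Ω), w i 0 x = 0) →
        -- the family of integral inequalities
        (∀ q : ℕ, 2 ≤ q → ∀ t : ℝ, 0 < t →
          (∫ x in Ω, Real.exp t * ∑ i, w i t x ^ q) +
            K₀ * (∫ s in (0 : ℝ)..t, ∫ x in Ω, Real.exp s *
              ∑ i, ‖BoundIter.weakGradient Ω (fun y => w i s y ^ ((q : ℝ) / 2)) x‖ ^ 2) ≤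
          K₁ * (q : ℝ) ^ α * (∫ s in (0 : ℝ)..t, ∫ x in Ω, Real.exp s * ∑ i, w i s x ^ q) +
            K₂ * (q : ℝ) ^ β * Real.exp t) →
        ∀ i, ∀ t : ℝ, 0 < t → ∀ᵐ x ∂(volume.restrict Ω),
          ENNReal.ofReal (w i t x) ≤
            ENNReal.ofReal K₃ * ((∑ j, BoundIter.normLinftyL1 Ω (w j)) + 1) := by
  have : IsFiniteMeasure (volume.restrict Ω) :=
    ⟨by simpa using hΩb.measure_lt_top⟩
  obtain ⟨C, hC, P, hCP⟩ := BoundIter.exists_iteration_constants d (α := α) (β := β)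
    hK₀ hK₁ hK₂ (BoundIter.unitBallVolume_pos d)
  set R : ℝ := 2 ^ P
  have hR : 1 ≤ R := one_le_pow₀ one_le_two
  -- With `q = 2 * 2 ^ k` one has `q ^ P = R * R ^ k`; the factor `R` independent of `k` goes into
  -- `D`.
  set D : ℝ := C * R
  have hD : 1 ≤ D := one_le_mul_of_one_le_of_one_le hC hR
  have hA : 0 < D * R := by positivity
  refine ⟨D * R, hA, fun n w hreg hw0 hH10 _ hineq i t ht => ?_⟩
  by_cases hS : ∑ j, BoundIter.normLinftyL1 Ω (w j) = ⊤
  · rw [hS, top_add, ENNReal.mul_top (by simpa using hA)]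
    exact ae_of_all _ fun _ => le_top
  have hH1 : ∀ m : ℕ, 1 ≤ m → ∀ i, ∀ T : ℝ, 0 < T →
      BoundIter.MemL2H1 Ω T (fun t x => w i t x ^ m) := fun m hm i T hT => by
    simpa only [BoundIter.rpow_two_mul_div_two] using (hreg i (2 * m) (by omega) T hT).1
  have hC0 : ∀ m : ℕ, 1 ≤ m → ∀ i, ∀ T : ℝ, 0 < T →
      BoundIter.MemC0L2 Ω T (fun t x => w i t x ^ m) := fun m hm i T hT => by
    simpa only [BoundIter.rpow_two_mul_div_two] using (hreg i (2 * m) (by omega) T hT).2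
  have hLp : ∀ m : ℕ, ∀ i, ∀ t : ℝ, 0 ≤ t →
      MemLp (fun x => w i t x ^ m) 2 (volume.restrict Ω) := fun m i t ht => by
    rcases Nat.eq_zero_or_pos m with rfl | hm
    · simpa using memLp_const (1 : ℝ)
    · exact (hC0 m hm i (t + 1) (by linarith)).memLp ⟨ht, by linarith⟩
  have hint : ∀ m : ℕ, ∀ i, ∀ t : ℝ, 0 ≤ t → IntegrableOn (fun x => w i t x ^ m) Ω :=
    fun m i t ht => (hLp m i t ht).integrable one_le_two
  set S := (∑ j, BoundIter.normLinftyL1 Ω (w j)).toReal with hSdef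
  -- The `+ 1` in the theorem starts the recursion at a value of at least `1`.
  have hY : 1 ≤ S + 1 := by
    linarith [ENNReal.toReal_nonneg (a := ∑ j, BoundIter.normLinftyL1 Ω (w j))]
  have step : ∀ k : ℕ, (∀ᵐ t ∂(volume.restrict (Ioi (0 : ℝ))),
      ∑ i, ∫ x in Ω, w i t x ^ 2 ^ k ≤ BoundIter.iterBound D R (S + 1) k) → ∀ t : ℝ, 0 < t →
      ∑ i, ∫ x in Ω, w i t x ^ 2 ^ (k + 1) ≤ BoundIter.iterBound D R (S + 1) (k + 1) := by
    intro k hB t ht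
    have hm : 1 ≤ 2 ^ k := Nat.one_le_two_pow
    obtain ⟨h, hh, hab, hle⟩ := hCP (2 * 2 ^ k) (by omega)
    have := BoundIter.integral_pow_step hΩo hm (hH1 _ hm) (hC0 _ hm) (hLp _) hw0 hH10
      (a := K₀) (b := K₁ * ((2 * 2 ^ k : ℕ) : ℝ) ^ α) (c := K₂ * ((2 * 2 ^ k : ℕ) : ℝ) ^ β)
      (by positivity) (fun t ht => by
        simpa only [BoundIter.rpow_two_mul_div_two] using hineq (2 * 2 ^ k) (by omega) t ht)
      hh hab hB ht
    rw [pow_succ']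
    refine (this.trans (hle _ (BoundIter.one_le_iterBound hD hR hY k))).trans_eq ?_
    rw [← BoundIter.iterBound_succ hD hR]
    have e : ((2 * 2 ^ k : ℕ) : ℝ) ^ P = R * R ^ k := by
      push_cast
      rw [mul_pow, ← pow_mul, ← pow_mul, mul_comm k P]
    rw [e]
    ring
  -- The `L^∞(0,∞;L¹)` norm bounds the first moment only for almost every `t`, hence the
  -- almost-everywhere form of the induction; `step` then gives exponents `2 ^ (k + 1)` at every `t
  -- > 0`.
  have base : ∀ᵐ t ∂(volume.restrict (Ioi (0 : ℝ))),
      ∑ i, ∫ x in Ω, w i t x ^ 2 ^ 0 ≤ BoundIter.iterBound D R (S + 1) 0 := by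
    rw [BoundIter.iterBound_zero hD hR]
    filter_upwards [BoundIter.sum_integral_le_toReal_sum_norm (fun i t ht => by
      simpa using hint 1 i t ht) hS] with t ht
    simp only [pow_zero, pow_one]
    linarith
  have all : ∀ k : ℕ, ∀ᵐ t ∂(volume.restrict (Ioi (0 : ℝ))),
      ∑ i, ∫ x in Ω, w i t x ^ 2 ^ k ≤ BoundIter.iterBound D R (S + 1) k := by
    intro k
    induction k with
    | zero => exact base
    | succ k ih =>
      filter_upwards [ae_restrict_mem measurableSet_Ioi] with t ht using step k ih t ht
  have hX := BoundIter.ae_le_of_integral_two_pow_le (hw0 i t ht.le) (X := D * R * (S + 1))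
    (by positivity) (fun k => hint _ i t ht.le) fun k => by
      refine le_trans ?_ ((step k (all k) t ht).trans (BoundIter.iterBound_le hD hR hY _))
      refine Finset.single_le_sum (f := fun j => ∫ x in Ω, w j t x ^ 2 ^ (k + 1))
        (fun j _ => integral_nonneg_of_ae ?_) (Finset.mem_univ i)
      filter_upwards [hw0 j t ht.le] with x hx using pow_nonneg hx _
  filter_upwards [hX] with x hx
  refine (ENNReal.ofReal_le_ofReal hx).trans_eq ?_
  rw [ENNReal.ofReal_mul hA.le, ENNReal.ofReal_add (by positivity) zero_le_one,
    ENNReal.ofReal_one, hSdef, ENNReal.ofReal_toReal hS]
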